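/- Consider the equations $\mathcal P_f$: $v_t+v_x^2+f(t,x)v_{xx}=0$, $f\neq0$, for a function $v(t,x)$ with the arbitrary element $f$, and the subclass $\mathcal P^3$ of those with $f$ a (nonzero) constant. An admissible transformation in $\mathcal P^3$ is a triple $(f,\tilde f,\varphi)$, where $\varphi$ is a (local) point transformation in the space of $(t,x,v)$ that maps $\mathcal P_f$ to $\mathcal P_{\tilde f}$. The generalized equivalence group of $\mathcal P^3$ consists of the (local) point transformations $\Phi:(t,x,v,f)\mapsto(\tilde t,\tilde x,\tilde v,\tilde f)$ in the space of $(t,x,v,f)$, $f\ne0$, with domain meeting every hyperplane $f=\mathrm{const}\neq0$, such that $\Phi$ maps constants $f\neq0$ to constants $\tilde f\ne0$, with every $\tilde f\neq0$ being attained, and such that for each constant $f\neq0$ the transformation of $(t,x,v)$ induced by $\Phi$ at $f$ maps $\mathcal P_f$ to $\mathcal P_{\tilde f}$. The generalized equivalence group of $\mathcal P^3$ is formed by the point transformations $\Phi$ in the space of $(t,x,v,f)$, $f\neq0$, acting on the values of $f$ as just described, that for each value of $f$ are of the form $$\tilde t=\frac{\alpha t+\beta}{\gamma t+\delta},\qquad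 \tilde x=\kappa\,\frac{x+\mu_1t+\mu_0}{\gamma t+\delta},\qquad \tilde v=\frac{\kappa^2f}{\alpha\delta-\beta\gamma}\ln\bigl|F^1\bigl(e^{v/f}+F^2\bigr)\bigr|,\qquad \tilde f=\frac{\kappa^2}{\alpha\delta-\beta\gamma}f,$$ where $\alpha,\beta,\gamma,\delta,\kappa,\mu_1,\mu_0$ are constants (with respect to $t,x,v$; they may depend on the value of $f$) with $\alpha\delta-\beta\gamma\neq0$ and $\kappa\neq0$, $$F^1=\begin{cases}k\sqrt{|\gamma t+\delta|}\,\exp\left(-\dfrac{(\gamma x-\mu_1\delta+\mu_0\gamma)^2}{4f\gamma(\gamma t+\delta)}\right),&\gamma\neq0,\\[3mm] k\exp\dfrac{2\mu_1x+\mu_1^2t}{4f},&\gamma=0,\end{cases}$$ $k$ is a nonzero constant (which may depend on $f$ as well), and $F^2=F^2(t,x)$ is, for each value of $f$, a smooth solution of the linear equation $F^2_t+fF^2_{xx}=0$. Here, for fixed $f$, the parameters are common to any connected open set of points $(t,x,v)$ of the domain of $\Phi$ that intersects each line parallel to the $v$-axis in an interval. The tuple $(\alpha,\beta,\gamma,\delta,\kappa)$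 is defined up to a nonzero multiplier: two such tuples can represent the same transformation, at a given value of $f$ and on a given nonempty open set, if and only if they are proportional. The subclass $\mathcal P^3$ is normalized in the generalized sense: every admissible transformation in $\mathcal P^3$ is induced by an element of its generalized equivalence group. -/

import Mathlib

open Set
open scoped ContDiff

noncomputable section

namespace PotBurgers

/-- The space of `(t, x)`. -/
abbrev Base : Type := ℝ × ℝ

/-- The space of `(t, x, v)`. -/
abbrev Space : Type := ℝ × ℝ × ℝ

/-- The space of `(t, x, v, f)`. -/
abbrev ExtSpace : Type := ℝ × ℝ × ℝ × ℝ

/-! ### The class of equations -/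

/-- `v` is a smooth solution on `U` of the generalized potential Burgers equation
`v_t + (v_x)^2 + f(t,x) v_xx = 0`. -/
def Solves (f : Base → ℝ) (U : Set Base) (v : Base → ℝ) : Prop :=
  ContDiffOn ℝ ∞ v U ∧
    ∀ t x : ℝ, (t, x) ∈ U →
      deriv (fun s => v (s, x)) t + (deriv (fun y => v (t, y)) x) ^ 2
        + f (t, x) * iteratedDeriv 2 (fun y => v (t, y)) x = 0

/-- The arbitrary elements of the class `v_t + (v_x)^2 + f(t,x) v_xx = 0`, `f ≠ 0`. -/
def PotClass : Set (Base → ℝ) :=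
  {f | ContDiff ℝ ∞ f ∧ ∀ z, f z ≠ 0}

/-- The subclass singled out by the condition `f = const`. -/
def P3 : Set (Base → ℝ) :=
  {f | f ∈ PotClass ∧ ∃ c : ℝ, ∀ z, f z = c}

/-! ### Point transformations and admissible transformations -/

/-- `φ` is a smooth diffeomorphism of the open set `D` onto its (open) image. -/
def IsDiffeoOn {E : Type*} [NormedAddCommGroup E] [NormedSpace ℝ E]
    (D : Set E) (φ : E → E) : Prop :=
  IsOpen D ∧ ContDiffOn ℝ ∞ φ D ∧ InjOn φ D ∧ ∀ p ∈ D, Function.Bijective (fderiv ℝ φ p)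

/-- The graph of a function defined on `U`. -/
def graphOver (U : Set Base) (v : Base → ℝ) : Set Space :=
  {p | (p.1, p.2.1) ∈ U ∧ p.2.2 = v (p.1, p.2.1)}

/-- `φ`, defined on `D`, maps the equation with arbitrary element `f` to the one with arbitrary
element `f'`: whenever `φ` takes the graph of a smooth function to the graph of a smooth function,
the first one is a solution of the former equation iff the second one is a solution of the latter.
All functions are local, that is, defined on arbitrary open sets. -/
def MapsEquation (f f' : Base → ℝ) (D : Set Space) (φ : Space → Space) : Prop :=
  ∀ (U U' : Set Base) (v v' : Base → ℝ),
    IsOpen U → IsOpen U' → ContDiffOn ℝ ∞ v U → ContDiffOn ℝ ∞ v' U' →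
    graphOver U v ⊆ D → φ '' graphOver U v = graphOver U' v' →
    (Solves f U v ↔ Solves f' U' v')

/-- `(f, f', φ)` is an admissible transformation: `φ` is a (local) point transformation in the space
of `(t, x, v)`, with domain `D`, that maps the equation with `f` to the equation with `f'`. -/
def IsAdmissible (f f' : Base → ℝ) (D : Set Space) (φ : Space → Space) : Prop :=
  D.Nonempty ∧ IsDiffeoOn D φ ∧ MapsEquation f f' D φ

/-! ### The generalized equivalence group and normalization in the generalized sense -/

/-- `Φ` is a (local) point transformation, with domain `Ω`, in the space of `(t, x, v, f)`,
`f ≠ 0`. -/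
def IsExtTransformation (Ω : Set ExtSpace) (Φ : ExtSpace → ExtSpace) : Prop :=
  IsDiffeoOn Ω Φ ∧ ∀ p ∈ Ω, p.2.2.2 ≠ 0 ∧ (Φ p).2.2.2 ≠ 0

/-- The points `(t, x, v)` such that `(t, x, v, f(t, x))` belongs to `Ω`. -/
def slice (Ω : Set ExtSpace) (f : Base → ℝ) : Set Space :=
  {p | (p.1, p.2.1, p.2.2, f (p.1, p.2.1)) ∈ Ω}

/-- The `(t, x, v)`-components of `Φ` evaluated at the arbitrary element `f`. -/
def induced (Φ : ExtSpace → ExtSpace) (f : Base → ℝ) : Space → Space := fun p =>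
  let q := Φ (p.1, p.2.1, p.2.2, f (p.1, p.2.1))
  (q.1, q.2.1, q.2.2.1)

/-- `Φ` takes the arbitrary element `f` to the arbitrary element `f'`, and the transformation of
`(t, x, v)` that it induces at `f` maps the equation with `f` to the equation with `f'`. -/
def Carries (Ω : Set ExtSpace) (Φ : ExtSpace → ExtSpace) (f f' : Base → ℝ) : Prop :=
  IsAdmissible f f' (slice Ω f) (induced Φ f) ∧
    ∀ t x v : ℝ, (t, x, v) ∈ slice Ω f →
      (Φ (t, x, v, f (t, x))).2.2.2
        = f' ((Φ (t, x, v, f (t, x))).1, (Φ (t, x, v, f (t, x))).2.1)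

/-- `Φ` belongs to the generalized equivalence group of the class with the arbitrary elements `S`:
it is a point transformation in the space of `(t, x, v, f)` whose `(t, x, v)`-components may
depend on `f`, and which acts on the whole class: every equation of the class is mapped to an
equation of the class, and every equation of the class is obtained in this way. -/
def IsGenEquivalence (S : Set (Base → ℝ)) (Ω : Set ExtSpace) (Φ : ExtSpace → ExtSpace) : Prop :=
  IsExtTransformation Ω Φ ∧
    (∀ f ∈ S, ∃ f' ∈ S, Carries Ω Φ f f') ∧
    (∀ f' ∈ S, ∃ f ∈ S, Carries Ω Φ f f')

/-- The class is normalized in the generalized sense: every admissible transformation in it is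
induced by an element of its generalized equivalence group. -/
def IsGenNormalized (S : Set (Base → ℝ)) : Prop :=
  ∀ f ∈ S, ∀ f' ∈ S, ∀ (D : Set Space) (φ : Space → Space), IsAdmissible f f' D φ →
    ∃ (Ω : Set ExtSpace) (Φ : ExtSpace → ExtSpace),
      IsGenEquivalence S Ω Φ ∧ Carries Ω Φ f f' ∧ slice Ω f = D ∧ EqOn (induced Φ f) φ D

/-! ### The explicit family of transformations -/

/-- The parameters of the family. -/
structure Params where
  α : ℝ
  β : ℝ
  γ : ℝ
  δ : ℝ
  κ : ℝ
  μ₁ : ℝ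
  μ₀ : ℝ
  k : ℝ
  F2 : Base → ℝ

namespace Params

/-- The tuple `(α, β, γ, δ, κ)`. -/
def tuple (P : Params) : Fin 5 → ℝ := ![P.α, P.β, P.γ, P.δ, P.κ]

/-- The determinant `αδ - βγ`. -/
def det (P : Params) : ℝ := P.α * P.δ - P.β * P.γ

/-- The factor `F¹` for the constant value `c` of `f`. -/
def F1 (P : Params) (c t x : ℝ) : ℝ :=
  if P.γ = 0 then
    P.k * Real.exp ((2 * P.μ₁ * x + P.μ₁ ^ 2 * t) / (4 * c))
  else
    P.k * Real.sqrt |P.γ * t + P.δ| *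
      Real.exp (-((P.γ * x - P.μ₁ * P.δ + P.μ₀ * P.γ) ^ 2 / (4 * c * P.γ * (P.γ * t + P.δ))))

/-- `F` is a smooth solution on `W` of the backward heat equation `F_t + c F_xx = 0`. -/
def SolvesHeat (c : ℝ) (W : Set Base) (F : Base → ℝ) : Prop :=
  ContDiffOn ℝ ∞ F W ∧
    ∀ t x : ℝ, (t, x) ∈ W →
      deriv (fun s => F (s, x)) t + c * iteratedDeriv 2 (fun y => F (t, y)) x = 0

/-- On the set `U` of points `(t, x, v)` and for the constant value `c` of `f`, the transformation
`Φ` is well defined by the explicit formulas with the parameters `P`, and the transformed value of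
`f` is `c'`. -/
def Represents (P : Params) (c c' : ℝ) (U : Set Space) (Φ : ExtSpace → ExtSpace) : Prop :=
  P.det ≠ 0 ∧ P.κ ≠ 0 ∧ P.k ≠ 0 ∧ c' = P.κ ^ 2 / P.det * c ∧
    SolvesHeat c {z | ∃ v, (z.1, z.2, v) ∈ U} P.F2 ∧
    ∀ t x v : ℝ, (t, x, v) ∈ U →
      P.γ * t + P.δ ≠ 0 ∧ Real.exp (v / c) + P.F2 (t, x) ≠ 0 ∧
      Φ (t, x, v, c) =
        ((P.α * t + P.β) / (P.γ * t + P.δ),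
          P.κ * ((x + P.μ₁ * t + P.μ₀) / (P.γ * t + P.δ)),
          P.κ ^ 2 * c / P.det * Real.log |P.F1 c t x * (Real.exp (v / c) + P.F2 (t, x))|,
          P.κ ^ 2 / P.det * c)

end Params

/-- A domain of the space of `(t, x, v)` on which a function of `(t, x, v)` that locally does not
depend on `v` is a function of `(t, x)`. -/
def IsRegularDomain (U : Set Space) : Prop :=
  IsOpen U ∧ IsConnected U ∧ ∀ t x : ℝ, {v : ℝ | (t, x, v) ∈ U}.OrdConnected

/-- For the constant value `c` of `f`, the transformation `Φ` is defined somewhere and is of the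
explicit form, with the transformed value `c'` of `f`; the parameters are the same all over each
regular domain (and may depend on `c`). -/
def HasExplicitForm (Ω : Set ExtSpace) (Φ : ExtSpace → ExtSpace) (c c' : ℝ) : Prop :=
  (∃ t x v : ℝ, (t, x, v, c) ∈ Ω) ∧
    ∀ U : Set Space, IsRegularDomain U → (∀ t x v : ℝ, (t, x, v) ∈ U → (t, x, v, c) ∈ Ω) →
      ∃ P : Params, P.Represents c c' U Φ

end PotBurgers

end

/-!
The substitution `v = c ln u` (Hopf-Cole) turns the equation with the constant arbitrary element `c`
into the linear heat equation `u_t + c u_xx = 0`. An admissible transformation between the equations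
with constants `c` and `c'` thus becomes a local point transformation
`(t, x, u) ↦ (T, X, W)`, `W = exp (v' / c')`, between two heat equations (`IsHeatMap`,
`isHeatMap_of_isAdmissible`), and the group is found from the determining equations of the latter.

*Determining equations.* The jets of solutions of the heat equation are unconstrained apart from the
equation itself, already for polynomial solutions of degree four (`heatPoly`), and by the inverse
function theorem the graph of such a solution is mapped to the graph of a solution as soon as
`(T, X)` is nondegenerate along it. So the transformed equation holds identically in the jet
variables (`IsHeatMap.jet`). The coefficient of `u_tt = c² u_xxxx` gives `T_x = T_u = 0`, that of
`u_xx` gives `X_u = 0` and `c X_x² = c' T_t`, and the powers of `u_x` give `W_uu = 0`,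
`2 c X_x W_xu = X_t W_u` and `X_x (W_t + c W_xx) = X_t W_x` (`T_projects`, `X_projects`,
`W_equations`).

*Integration.* Put `ρ = X_t / X_x`. Differentiation of `c X_x² = c' T_t` gives `X_xx = 0`,
whence `ρ_xx = 0`, and compatibility of the equations for `W_u` is `ρ_t = ρ ρ_x`
(`drift_equations`). It follows that `σ = 1 / X_x` is affine in `t`, and so are
`X σ - x` and `T σ`, which is the fractional-linear form of `T` and `X`
(`exists_fractional_linear`). The functions `W_u` and `F¹` have the same logarithmic derivatives, so
`W_u = F¹` for a suitable `k`, and `F² = W / W_u - u` solves the heat equation (`exists_params`).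
Every constant of integration is found from the vanishing of a gradient on a connected set; this is
why the parameters are common to a whole regular domain, on which, moreover, `F²` is a function of
`(t, x)` (`exists_descend`).

*Converse.* A transformation of the explicit form intertwines the heat operators up to nonvanishing
factors (`Params.heatOp_explicit`), so the two equations are equivalent at corresponding points of
the graphs (`HasExplicitForm.carries`).

*Normalization.* The scaling `(t, x, v) ↦ (t / l, x, l v)` maps the equation with constant `c` to
the one with constant `l c`. An admissible transformation `φ` from `c` to `c'` is extended to every
value `f = l c` by its conjugate under the scaling with `l = f / c` (`isGenNormalized_P3`).
-/

noncomputable section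

namespace PotBurgers

open Filter Topology

/-! ### Directional derivatives of smooth functions -/

section Calculus

variable {E : Type*} [NormedAddCommGroup E] [NormedSpace ℝ E] {F G : E → ℝ} {p e e' : E} {U : Set E}

/-- The derivative of `F` in the direction `e`, as a function of the point. -/
def pd (e : E) (F : E → ℝ) (p : E) : ℝ := fderiv ℝ F p e

theorem differentiableAt_of_smooth (h : ContDiffAt ℝ ∞ F p) : DifferentiableAt ℝ F p :=
  h.differentiableAt (by simp)

theorem pd_congr (h : F =ᶠ[𝓝 p] G) : pd e F p = pd e G p := by
  simp [pd, h.fderiv_eq]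

theorem pd_eventuallyEq (h : F =ᶠ[𝓝 p] G) : pd e F =ᶠ[𝓝 p] pd e G :=
  h.fderiv.mono fun _ hq => congrArg (fun L : E →L[ℝ] ℝ => L e) hq

theorem pd_congr_on (hU : IsOpen U) (h : ∀ q ∈ U, F q = G q) (hp : p ∈ U) :
    pd e F p = pd e G p :=
  pd_congr (eventually_of_mem (hU.mem_nhds hp) h)

@[fun_prop]
theorem contDiffAt_pd (e : E) (h : ContDiffAt ℝ ∞ F p) : ContDiffAt ℝ ∞ (pd e F) p :=
  (h.fderiv_right (m := ∞) (by simp)).clm_apply contDiffAt_const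

theorem pd_const (a : ℝ) : pd e (fun _ => a) p = 0 := by simp [pd]

theorem pd_eq_zero_on {a : ℝ} (hU : IsOpen U) (h : ∀ q ∈ U, F q = a) (hp : p ∈ U) :
    pd e F p = 0 := by
  rw [pd_congr_on hU h hp, pd_const]

theorem pd_add (hF : ContDiffAt ℝ ∞ F p) (hG : ContDiffAt ℝ ∞ G p) :
    pd e (fun q => F q + G q) p = pd e F p + pd e G p := by
  simp [pd, fderiv_fun_add (differentiableAt_of_smooth hF) (differentiableAt_of_smooth hG)]

theorem pd_sub (hF : ContDiffAt ℝ ∞ F p) (hG : ContDiffAt ℝ ∞ G p) :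
    pd e (fun q => F q - G q) p = pd e F p - pd e G p := by
  simp [pd, fderiv_fun_sub (differentiableAt_of_smooth hF) (differentiableAt_of_smooth hG)]

theorem pd_mul (hF : ContDiffAt ℝ ∞ F p) (hG : ContDiffAt ℝ ∞ G p) :
    pd e (fun q => F q * G q) p = F p * pd e G p + pd e F p * G p := by
  simp [pd, fderiv_fun_mul (differentiableAt_of_smooth hF) (differentiableAt_of_smooth hG),
    mul_comm]

theorem pd_const_mul (a : ℝ) (hF : ContDiffAt ℝ ∞ F p) :
    pd e (fun q => a * F q) p = a * pd e F p := by
  rw [pd_mul contDiffAt_const hF, pd_const]; ring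

theorem pd_comp_real {f : ℝ → ℝ} {f' : ℝ} (hf : HasDerivAt f f' (F p)) (hF : ContDiffAt ℝ ∞ F p) :
    pd e (fun q => f (F q)) p = f' * pd e F p := by
  have := (hf.comp_hasFDerivAt p (differentiableAt_of_smooth hF).hasFDerivAt).fderiv
  simp only [pd]
  rw [show (fun q => f (F q)) = f ∘ F from rfl, this]
  simp

theorem pd_inv (hF : ContDiffAt ℝ ∞ F p) (h0 : F p ≠ 0) :
    pd e (fun q => (F q)⁻¹) p = -pd e F p / F p ^ 2 := by
  rw [pd_comp_real (hasDerivAt_inv h0) hF]; ring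

theorem pd_div (hF : ContDiffAt ℝ ∞ F p) (hG : ContDiffAt ℝ ∞ G p) (h0 : G p ≠ 0) :
    pd e (fun q => F q / G q) p = (pd e F p * G p - F p * pd e G p) / G p ^ 2 := by
  simp only [div_eq_mul_inv]
  rw [pd_mul (G := fun q => (G q)⁻¹) hF (hG.inv h0), pd_inv hG h0]
  field_simp
  ring

theorem pd_comm (hF : ContDiffAt ℝ ∞ F p) : pd e (pd e' F) p = pd e' (pd e F) p := by
  have h2 : ContDiffAt ℝ ∞ (fderiv ℝ F) p := hF.fderiv_right (m := ∞) (by simp)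
  have hd := h2.differentiableAt (by simp)
  have key : ∀ a b : E, pd a (pd b F) p = fderiv ℝ (fderiv ℝ F) p a b := by
    intro a b
    have := (hd.hasFDerivAt.clm_apply (hasFDerivAt_const b p)).fderiv
    simp only [pd]
    rw [show (pd b F) = fun q => fderiv ℝ F q b from rfl, this]
    simp
  rw [key, key]
  exact (hF.isSymmSndFDerivAt (by simp; exact WithTop.coe_le_coe.2 (le_top : (2 : ℕ∞) ≤ ⊤))).eq e e'

end Calculus

/-! ### Partial derivatives in coordinates -/

/-- The direction of `t` in the space of `(t, x)`. -/
def et : Base := (1, 0)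
/-- The direction of `x` in the space of `(t, x)`. -/
def ex : Base := (0, 1)
/-- The direction of `t` in the space of `(t, x, u)`. -/
def e₁ : Space := (1, 0, 0)
/-- The direction of `x` in the space of `(t, x, u)`. -/
def e₂ : Space := (0, 1, 0)
/-- The direction of `u` in the space of `(t, x, u)`. -/
def e₃ : Space := (0, 0, 1)

theorem fderiv_base (F : Base → ℝ) (z h : Base) :
    fderiv ℝ F z h = pd et F z * h.1 + pd ex F z * h.2 := by
  have : h = h.1 • et + h.2 • ex := by ext <;> simp [et, ex]
  conv_lhs => rw [this]
  simp [pd, mul_comm]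

theorem fderiv_space (F : Space → ℝ) (p h : Space) :
    fderiv ℝ F p h = pd e₁ F p * h.1 + pd e₂ F p * h.2.1 + pd e₃ F p * h.2.2 := by
  have : h = h.1 • e₁ + h.2.1 • e₂ + h.2.2 • e₃ := by ext <;> simp [e₁, e₂, e₃]
  conv_lhs => rw [this]
  simp [pd, mul_comm]

/-- Chain rule for a substitution of functions of `(t, x)` into a function of two variables. -/
theorem pd_comp_base {W a b : Base → ℝ} {z e : Base} (hW : ContDiffAt ℝ ∞ W (a z, b z))
    (ha : ContDiffAt ℝ ∞ a z) (hb : ContDiffAt ℝ ∞ b z) :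
    pd e (fun y => W (a y, b y)) z
      = pd et W (a z, b z) * pd e a z + pd ex W (a z, b z) * pd e b z := by
  have h1 := (differentiableAt_of_smooth ha).hasFDerivAt.prodMk
    (differentiableAt_of_smooth hb).hasFDerivAt
  have h2 := ((differentiableAt_of_smooth hW).hasFDerivAt.comp z h1).fderiv
  rw [show pd e (fun y => W (a y, b y)) z = fderiv ℝ (W ∘ fun y => (a y, b y)) z e from rfl, h2,
    ContinuousLinearMap.comp_apply, fderiv_base]
  simp [pd]

/-- Chain rule for the restriction of a function of `(t, x, u)` to the graph of a function. -/
theorem pd_graph {F : Space → ℝ} {u : Base → ℝ} {z e : Base}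
    (hF : ContDiffAt ℝ ∞ F (z.1, z.2, u z)) (hu : ContDiffAt ℝ ∞ u z) :
    pd e (fun y => F (y.1, y.2, u y)) z
      = pd e₁ F (z.1, z.2, u z) * e.1 + pd e₂ F (z.1, z.2, u z) * e.2
        + pd e₃ F (z.1, z.2, u z) * pd e u z := by
  have h1 := (hasFDerivAt_fst (𝕜 := ℝ) (p := z)).prodMk ((hasFDerivAt_snd (𝕜 := ℝ) (p := z)).prodMk
    (differentiableAt_of_smooth hu).hasFDerivAt)
  have h2 := ((differentiableAt_of_smooth hF).hasFDerivAt.comp z h1).fderiv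
  rw [show pd e (fun y => F (y.1, y.2, u y)) z
    = fderiv ℝ (F ∘ fun y => (y.1, y.2, u y)) z e from rfl, h2,
    ContinuousLinearMap.comp_apply, fderiv_space]
  simp [pd]

theorem pd_graph_et {F : Space → ℝ} {u : Base → ℝ} {z : Base}
    (hF : ContDiffAt ℝ ∞ F (z.1, z.2, u z)) (hu : ContDiffAt ℝ ∞ u z) :
    pd et (fun y => F (y.1, y.2, u y)) z
      = pd e₁ F (z.1, z.2, u z) + pd e₃ F (z.1, z.2, u z) * pd et u z := by
  rw [pd_graph hF hu]; simp [et]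

theorem pd_graph_ex {F : Space → ℝ} {u : Base → ℝ} {z : Base}
    (hF : ContDiffAt ℝ ∞ F (z.1, z.2, u z)) (hu : ContDiffAt ℝ ∞ u z) :
    pd ex (fun y => F (y.1, y.2, u y)) z
      = pd e₂ F (z.1, z.2, u z) + pd e₃ F (z.1, z.2, u z) * pd ex u z := by
  rw [pd_graph hF hu]; simp [ex]

theorem hasDerivAt_slice_t {F : Base → ℝ} {t x : ℝ} (hF : ContDiffAt ℝ ∞ F (t, x)) :
    HasDerivAt (fun s => F (s, x)) (pd et F (t, x)) t := by
  have := (differentiableAt_of_smooth hF).hasFDerivAt.comp_hasDerivAt t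
    ((hasDerivAt_id t).prodMk (hasDerivAt_const t x))
  simpa [pd, et, Function.comp_def] using this

theorem hasDerivAt_slice_x {F : Base → ℝ} {t x : ℝ} (hF : ContDiffAt ℝ ∞ F (t, x)) :
    HasDerivAt (fun y => F (t, y)) (pd ex F (t, x)) x := by
  have := (differentiableAt_of_smooth hF).hasFDerivAt.comp_hasDerivAt x
    ((hasDerivAt_const x t).prodMk (hasDerivAt_id x))
  simpa [pd, ex, Function.comp_def] using this

theorem pd_et_of_hasDerivAt {F : Base → ℝ} {t x a : ℝ} (hF : ContDiffAt ℝ ∞ F (t, x))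
    (h : HasDerivAt (fun s => F (s, x)) a t) : pd et F (t, x) = a :=
  (hasDerivAt_slice_t hF).unique h

theorem pd_ex_of_hasDerivAt {F : Base → ℝ} {t x a : ℝ} (hF : ContDiffAt ℝ ∞ F (t, x))
    (h : HasDerivAt (fun y => F (t, y)) a x) : pd ex F (t, x) = a :=
  (hasDerivAt_slice_x hF).unique h

theorem iteratedDeriv_slice_x {F : Base → ℝ} {t x : ℝ} (h : ∀ᶠ z in 𝓝 (t, x), ContDiffAt ℝ ∞ F z) :
    iteratedDeriv 2 (fun y => F (t, y)) x = pd ex (pd ex F) (t, x) := by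
  rw [iteratedDeriv_succ, iteratedDeriv_one,
    ← (hasDerivAt_slice_x (contDiffAt_pd ex h.self_of_nhds)).deriv]
  apply Filter.EventuallyEq.deriv_eq
  have hc : ContinuousAt (fun y : ℝ => ((t, y) : Base)) x := by fun_prop
  exact (hc.eventually h).mono fun y hy => (hasDerivAt_slice_x hy).deriv

/-! ### The heat and potential Burgers operators -/

/-- The left hand side of the heat equation `u_t + c u_xx = 0`. -/
def heatOp (c : ℝ) (u : Base → ℝ) (z : Base) : ℝ := pd et u z + c * pd ex (pd ex u) z

/-- The left hand side of the potential Burgers equation `v_t + v_x² + c v_xx = 0`. -/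
def burgersOp (c : ℝ) (v : Base → ℝ) (z : Base) : ℝ :=
  pd et v z + pd ex v z ^ 2 + c * pd ex (pd ex v) z

theorem solves_iff {f : Base → ℝ} {c : ℝ} (hf : ∀ z, f z = c) {U : Set Base} (hU : IsOpen U)
    {v : Base → ℝ} :
    Solves f U v ↔ ContDiffOn ℝ ∞ v U ∧ ∀ z ∈ U, burgersOp c v z = 0 := by
  refine and_congr_right fun hv => ?_
  have hz : ∀ t x, (t, x) ∈ U → ContDiffAt ℝ ∞ v (t, x) := fun t x h =>
    hv.contDiffAt (hU.mem_nhds h)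
  have hn : ∀ t x, (t, x) ∈ U → ∀ᶠ z in 𝓝 (t, x), ContDiffAt ℝ ∞ v z := fun t x h =>
    eventually_of_mem (hU.mem_nhds h) fun z hm => hz z.1 z.2 hm
  constructor
  · rintro h ⟨t, x⟩ hm
    have := h t x hm
    rwa [(hasDerivAt_slice_t (hz t x hm)).deriv, (hasDerivAt_slice_x (hz t x hm)).deriv,
      iteratedDeriv_slice_x (hn t x hm), hf] at this
  · intro h t x hm
    rw [(hasDerivAt_slice_t (hz t x hm)).deriv, (hasDerivAt_slice_x (hz t x hm)).deriv,
      iteratedDeriv_slice_x (hn t x hm), hf]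
    exact h _ hm

theorem solvesHeat_iff {c : ℝ} {U : Set Base} (hU : IsOpen U) {F : Base → ℝ} :
    Params.SolvesHeat c U F ↔ ContDiffOn ℝ ∞ F U ∧ ∀ z ∈ U, heatOp c F z = 0 := by
  refine and_congr_right fun hv => ?_
  have hz : ∀ t x, (t, x) ∈ U → ContDiffAt ℝ ∞ F (t, x) := fun t x h =>
    hv.contDiffAt (hU.mem_nhds h)
  have hn : ∀ t x, (t, x) ∈ U → ∀ᶠ z in 𝓝 (t, x), ContDiffAt ℝ ∞ F z := fun t x h =>
    eventually_of_mem (hU.mem_nhds h) fun z hm => hz z.1 z.2 hm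
  constructor
  · rintro h ⟨t, x⟩ hm
    have := h t x hm
    rwa [(hasDerivAt_slice_t (hz t x hm)).deriv, iteratedDeriv_slice_x (hn t x hm)] at this
  · intro h t x hm
    rw [(hasDerivAt_slice_t (hz t x hm)).deriv, iteratedDeriv_slice_x (hn t x hm)]
    exact h _ hm

/-- The Hopf-Cole substitution `v = c ln u` linearizes the potential Burgers equation. -/
theorem heatOp_exp {c : ℝ} (hc : c ≠ 0) {v : Base → ℝ} {z : Base}
    (hv' : ∀ᶠ y in 𝓝 z, ContDiffAt ℝ ∞ v y) :
    heatOp c (fun y => Real.exp (v y / c)) z = Real.exp (v z / c) / c * burgersOp c v z := by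
  have hv := hv'.self_of_nhds
  have h1 : ∀ (e : Base) (y : Base), ContDiffAt ℝ ∞ v y →
      pd e (fun y => Real.exp (v y / c)) y = Real.exp (v y / c) / c * pd e v y := by
    intro e y hy
    have hd : HasDerivAt (fun r : ℝ => Real.exp (r / c)) (Real.exp (v y / c) * (1 / c)) (v y) :=
      ((hasDerivAt_id (v y)).div_const c).exp
    rw [pd_comp_real hd hy]; ring
  have h2 : pd ex (pd ex (fun y => Real.exp (v y / c))) z
      = pd ex (fun y => Real.exp (v y / c) * (c⁻¹ * pd ex v y)) z :=
    pd_congr (hv'.mono fun y hy => by rw [h1 ex y hy]; ring)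
  have h3 : ContDiffAt ℝ ∞ (fun y => Real.exp (v y / c)) z := by fun_prop
  rw [heatOp, burgersOp, h2, pd_mul h3 (by fun_prop), pd_const_mul _ (by fun_prop), h1 et z hv,
    h1 ex z hv]
  field_simp
  ring

theorem heatOp_congr {c : ℝ} {u u' : Base → ℝ} {z : Base} (h : u =ᶠ[𝓝 z] u') :
    heatOp c u z = heatOp c u' z := by
  rw [heatOp, heatOp, pd_congr h, pd_congr (pd_eventuallyEq h)]

/-! ### Second-order chain rules and jets of solutions of the heat equation -/

/-- The second-order chain rule for a substitution of functions of `(t, x)` into a function of two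
variables. -/
theorem pd_pd_comp_base {w W a b : Base → ℝ} {z e e' : Base}
    (hW : ∀ᶠ y in 𝓝 (a z, b z), ContDiffAt ℝ ∞ W y)
    (ha : ∀ᶠ y in 𝓝 z, ContDiffAt ℝ ∞ a y) (hb : ∀ᶠ y in 𝓝 z, ContDiffAt ℝ ∞ b y)
    (hw : ∀ᶠ y in 𝓝 z, W (a y, b y) = w y) :
    pd e (pd e' w) z
      = (pd et (pd et W) (a z, b z) * pd e a z + pd et (pd ex W) (a z, b z) * pd e b z) * pd e' a z
        + (pd et (pd ex W) (a z, b z) * pd e a z + pd ex (pd ex W) (a z, b z) * pd e b z) * pd e' b z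
        + pd et W (a z, b z) * pd e (pd e' a) z + pd ex W (a z, b z) * pd e (pd e' b) z := by
  have ha0 := ha.self_of_nhds
  have hb0 := hb.self_of_nhds
  have hW0 := hW.self_of_nhds
  have hc : ContinuousAt (fun y => (a y, b y)) z := ha0.continuousAt.prodMk hb0.continuousAt
  have h1 : pd e' w =ᶠ[𝓝 z]
      fun y => pd et W (a y, b y) * pd e' a y + pd ex W (a y, b y) * pd e' b y := by
    have h2 : pd e' w =ᶠ[𝓝 z] pd e' (fun y => W (a y, b y)) :=
      pd_eventuallyEq (hw.mono fun y hy => hy.symm)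
    filter_upwards [h2, ha, hb, hc.eventually hW] with y h3 h4 h5 h6
    rw [h3, pd_comp_base h6 h4 h5]
  have hg : ContDiffAt ℝ ∞ (fun y => (a y, b y)) z := ha0.prodMk hb0
  have hWt : ContDiffAt ℝ ∞ (fun y => pd et W (a y, b y)) z :=
    ContDiffAt.comp z (f := fun y => (a y, b y)) (contDiffAt_pd et hW0) hg
  have hWx : ContDiffAt ℝ ∞ (fun y => pd ex W (a y, b y)) z :=
    ContDiffAt.comp z (f := fun y => (a y, b y)) (contDiffAt_pd ex hW0) hg
  rw [pd_congr h1, pd_add (hWt.mul (contDiffAt_pd e' ha0)) (hWx.mul (contDiffAt_pd e' hb0)),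
    pd_mul hWt (contDiffAt_pd e' ha0), pd_mul hWx (contDiffAt_pd e' hb0),
    pd_comp_base (contDiffAt_pd et hW0) ha0 hb0, pd_comp_base (contDiffAt_pd ex hW0) ha0 hb0,
    pd_comm (e := ex) (e' := et) hW0]
  ring

/-- The second-order chain rule for the restriction of a function of `(t, x, u)` to the graph of a
function. -/
theorem pd_pd_graph {F : Space → ℝ} {u : Base → ℝ} {z e e' : Base}
    (hF : ∀ᶠ p in 𝓝 ((z.1, z.2, u z) : Space), ContDiffAt ℝ ∞ F p)
    (hu : ∀ᶠ y in 𝓝 z, ContDiffAt ℝ ∞ u y) :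
    pd e (pd e' fun y => F (y.1, y.2, u y)) z
      = (pd e₁ (pd e₁ F) (z.1, z.2, u z) * e.1 + pd e₂ (pd e₁ F) (z.1, z.2, u z) * e.2
          + pd e₃ (pd e₁ F) (z.1, z.2, u z) * pd e u z) * e'.1
        + (pd e₁ (pd e₂ F) (z.1, z.2, u z) * e.1 + pd e₂ (pd e₂ F) (z.1, z.2, u z) * e.2
          + pd e₃ (pd e₂ F) (z.1, z.2, u z) * pd e u z) * e'.2
        + (pd e₁ (pd e₃ F) (z.1, z.2, u z) * e.1 + pd e₂ (pd e₃ F) (z.1, z.2, u z) * e.2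
          + pd e₃ (pd e₃ F) (z.1, z.2, u z) * pd e u z) * pd e' u z
        + pd e₃ F (z.1, z.2, u z) * pd e (pd e' u) z := by
  have hF0 := hF.self_of_nhds
  have hu0 := hu.self_of_nhds
  have hg : ContDiffAt ℝ ∞ (fun y : Base => ((y.1, y.2, u y) : Space)) z :=
    contDiffAt_fst.prodMk (contDiffAt_snd.prodMk hu0)
  have h1 : (pd e' fun y => F (y.1, y.2, u y)) =ᶠ[𝓝 z]
      fun y => (e'.1 * pd e₁ F (y.1, y.2, u y) + e'.2 * pd e₂ F (y.1, y.2, u y))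
        + pd e₃ F (y.1, y.2, u y) * pd e' u y := by
    filter_upwards [hu, hg.continuousAt.eventually hF] with y h3 h4
    rw [pd_graph h4 h3]
    ring
  have hi : ∀ d : Space, ContDiffAt ℝ ∞ (fun y : Base => pd d F (y.1, y.2, u y)) z := fun d =>
    ContDiffAt.comp z (f := fun y : Base => ((y.1, y.2, u y) : Space)) (contDiffAt_pd d hF0) hg
  have hd : ∀ d : Space, ContDiffAt ℝ ∞ (pd d F) (z.1, z.2, u z) := fun d => contDiffAt_pd d hF0
  have h2 := hi e₁
  have h3 := hi e₂
  have h4 := hi e₃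
  rw [pd_congr h1, pd_add (by fun_prop) (by fun_prop), pd_add (by fun_prop) (by fun_prop),
    pd_const_mul _ h2, pd_const_mul _ h3, pd_mul h4 (by fun_prop), pd_graph (hd e₁) hu0,
    pd_graph (hd e₂) hu0, pd_graph (hd e₃) hu0]
  ring

/-- The polynomial solution of `u_t + c u_xx = 0` with the value `a₀` and the values `a₁`, …, `a₄` of
its first four derivatives with respect to `x` at the point `z`, and with vanishing higher ones. -/
def heatPoly (c : ℝ) (z : Base) (a₀ a₁ a₂ a₃ a₄ : ℝ) (y : Base) : ℝ :=
  a₀ + a₁ * (y.2 - z.2) + a₂ * ((y.2 - z.2) ^ 2 / 2 - c * (y.1 - z.1))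
    + a₃ * ((y.2 - z.2) ^ 3 / 6 - c * (y.1 - z.1) * (y.2 - z.2))
    + a₄ * ((y.2 - z.2) ^ 4 / 24 - c * (y.1 - z.1) * (y.2 - z.2) ^ 2 / 2
      + c ^ 2 * (y.1 - z.1) ^ 2 / 2)

section HeatPoly

variable (c : ℝ) (z : Base) (a₀ a₁ a₂ a₃ a₄ : ℝ)

theorem contDiff_heatPoly : ContDiff ℝ ∞ (heatPoly c z a₀ a₁ a₂ a₃ a₄) := by
  unfold heatPoly; fun_prop

theorem pd_ex_heatPoly :
    pd ex (heatPoly c z a₀ a₁ a₂ a₃ a₄) = heatPoly c z a₁ a₂ a₃ a₄ 0 := by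
  funext ⟨t, x⟩
  refine pd_ex_of_hasDerivAt (contDiff_heatPoly ..).contDiffAt ?_
  have hx : HasDerivAt (fun y : ℝ => y - z.2) 1 x := (hasDerivAt_id x).sub_const _
  have := ((((hasDerivAt_const x a₀).add (hx.const_mul a₁)).add
    ((((hx.pow 2).div_const 2).sub_const (c * (t - z.1))).const_mul a₂)).add
    ((((hx.pow 3).div_const 6).sub (hx.const_mul (c * (t - z.1)))).const_mul a₃)).add
    (((((hx.pow 4).div_const 24).sub (((hx.pow 2).const_mul (c * (t - z.1))).div_const 2)).add_const
      (c ^ 2 * (t - z.1) ^ 2 / 2)).const_mul a₄)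
  refine HasDerivAt.congr_deriv this ?_
  simp only [heatPoly]
  push_cast
  ring

theorem pd_et_heatPoly (y : Base) :
    pd et (heatPoly c z a₀ a₁ a₂ a₃ a₄) y = -c * heatPoly c z a₂ a₃ a₄ 0 0 y := by
  obtain ⟨t, x⟩ := y
  refine pd_et_of_hasDerivAt (contDiff_heatPoly ..).contDiffAt ?_
  have ht : HasDerivAt (fun y : ℝ => y - z.1) 1 t := (hasDerivAt_id t).sub_const _
  have h1 := ht.const_mul c
  have := ((((hasDerivAt_const t (a₀ + a₁ * (x - z.2))).add
    ((h1.const_sub ((x - z.2) ^ 2 / 2)).const_mul a₂))).add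
    (((h1.mul_const (x - z.2)).const_sub ((x - z.2) ^ 3 / 6)).const_mul a₃)).add
    (((((h1.mul_const ((x - z.2) ^ 2)).div_const 2).const_sub ((x - z.2) ^ 4 / 24)).add
      (((ht.pow 2).const_mul (c ^ 2)).div_const 2)).const_mul a₄)
  refine HasDerivAt.congr_deriv this ?_
  simp only [heatPoly]
  push_cast
  ring

theorem heatPoly_self : heatPoly c z a₀ a₁ a₂ a₃ a₄ z = a₀ := by simp [heatPoly]

theorem heatOp_heatPoly (y : Base) : heatOp c (heatPoly c z a₀ a₁ a₂ a₃ a₄) y = 0 := by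
  rw [heatOp, pd_ex_heatPoly, pd_ex_heatPoly, pd_et_heatPoly]; ring

end HeatPoly

/-- `(T, X, W)` is a local point transformation on the open set `D` of the space of `(t, x, u)` that
takes the solutions of `u_t + c u_xx = 0` to solutions of `w_t + c' w_xx = 0`. Nondegeneracy is the
linear independence of the three differentials. Only the graphs over which `(T, X)` is a local
diffeomorphism are transformed to graphs. -/
structure IsHeatMap (c c' : ℝ) (D : Set Space) (T X W : Space → ℝ) : Prop where
  isOpen : IsOpen D
  smooth_T : ∀ p ∈ D, ContDiffAt ℝ ∞ T p
  smooth_X : ∀ p ∈ D, ContDiffAt ℝ ∞ X p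
  smooth_W : ∀ p ∈ D, ContDiffAt ℝ ∞ W p
  indep : ∀ p ∈ D, ∀ l m n : ℝ,
    l * pd e₁ T p + m * pd e₁ X p + n * pd e₁ W p = 0 →
    l * pd e₂ T p + m * pd e₂ X p + n * pd e₂ W p = 0 →
    l * pd e₃ T p + m * pd e₃ X p + n * pd e₃ W p = 0 → l = 0 ∧ m = 0 ∧ n = 0
  maps : ∀ (z : Base) (u : Base → ℝ), (z.1, z.2, u z) ∈ D → ContDiff ℝ ∞ u →
    (∀ y, heatOp c u y = 0) →
    pd et (fun y => T (y.1, y.2, u y)) z * pd ex (fun y => X (y.1, y.2, u y)) z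
      - pd ex (fun y => T (y.1, y.2, u y)) z * pd et (fun y => X (y.1, y.2, u y)) z ≠ 0 →
    ∃ w : Base → ℝ,
      (∀ᶠ y in 𝓝 (T (z.1, z.2, u z), X (z.1, z.2, u z)), ContDiffAt ℝ ∞ w y) ∧
      heatOp c' w (T (z.1, z.2, u z), X (z.1, z.2, u z)) = 0 ∧
      ∀ᶠ y in 𝓝 z, w (T (y.1, y.2, u y), X (y.1, y.2, u y)) = W (y.1, y.2, u y)

/-- The second derivative of the restriction of `F` to the graph of a function `u`, in two of the
directions of `t` and `x`. Here `i` and `j` are the directions as vectors of the space of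
`(t, x, u)`, the numbers `r` and `s` are the derivatives of `u` in these directions, and `rs` is the
second derivative of `u`. -/
def jet₂ (F : Space → ℝ) (p : Space) (r s rs : ℝ) (i j : Space) : ℝ :=
  pd i (pd j F) p + pd e₃ (pd j F) p * r + (pd i (pd e₃ F) p + pd e₃ (pd e₃ F) p * r) * s
    + pd e₃ F p * rs

/-- The consequence of `IsHeatMap` in terms of jets: here `q`, `q₂`, `q₃`, `q₄` are the derivatives
of a solution `u` with respect to `x`, the other derivatives being found from the equation, and the
`w`'s are the derivatives of the transformed solution. The disjunction lists the second derivatives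
`tt`, `tx` and `xx`. -/
theorem IsHeatMap.jet {c c' : ℝ} {D : Set Space} {T X W : Space → ℝ}
    (h : IsHeatMap c c' D T X W) {p : Space} (hp : p ∈ D) (q q₂ q₃ q₄ : ℝ)
    (hJ : (pd e₁ T p + pd e₃ T p * (-c * q₂)) * (pd e₂ X p + pd e₃ X p * q)
      - (pd e₂ T p + pd e₃ T p * q) * (pd e₁ X p + pd e₃ X p * (-c * q₂)) ≠ 0) :
    ∃ wa wb waa wab wbb : ℝ, wa + c' * wbb = 0 ∧
      pd e₁ W p + pd e₃ W p * (-c * q₂) = wa * (pd e₁ T p + pd e₃ T p * (-c * q₂))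
        + wb * (pd e₁ X p + pd e₃ X p * (-c * q₂)) ∧
      pd e₂ W p + pd e₃ W p * q = wa * (pd e₂ T p + pd e₃ T p * q)
        + wb * (pd e₂ X p + pd e₃ X p * q) ∧
      (∀ (r s rs : ℝ) (i j : Space),
        (r = -c * q₂ ∧ s = -c * q₂ ∧ rs = c ^ 2 * q₄ ∧ i = e₁ ∧ j = e₁) ∨
        (r = -c * q₂ ∧ s = q ∧ rs = -c * q₃ ∧ i = e₁ ∧ j = e₂) ∨
        (r = q ∧ s = q ∧ rs = q₂ ∧ i = e₂ ∧ j = e₂) →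
        jet₂ W p r s rs i j =
          (waa * (pd i T p + pd e₃ T p * r) + wab * (pd i X p + pd e₃ X p * r))
              * (pd j T p + pd e₃ T p * s)
            + (wab * (pd i T p + pd e₃ T p * r) + wbb * (pd i X p + pd e₃ X p * r))
              * (pd j X p + pd e₃ X p * s)
            + wa * jet₂ T p r s rs i j + wb * jet₂ X p r s rs i j) := by
  obtain ⟨t, x, u₀⟩ := p
  set z : Base := (t, x) with hz
  set u := heatPoly c z u₀ q q₂ q₃ q₄ with hu
  have hus : ContDiff ℝ ∞ u := contDiff_heatPoly ..
  have huz : u z = u₀ := heatPoly_self ..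
  have hpz : ((z.1, z.2, u z) : Space) = (t, x, u₀) := by rw [huz]
  have ux : pd ex u z = q := by rw [hu, pd_ex_heatPoly, heatPoly_self]
  have ut : pd et u z = -c * q₂ := by rw [hu, pd_et_heatPoly, heatPoly_self]
  have uxx : pd ex (pd ex u) z = q₂ := by rw [hu, pd_ex_heatPoly, pd_ex_heatPoly, heatPoly_self]
  have utx : pd et (pd ex u) z = -c * q₃ := by
    rw [hu, pd_ex_heatPoly, pd_et_heatPoly, heatPoly_self]
  have utt : pd et (pd et u) z = c ^ 2 * q₄ := by
    have h1 : pd et u = fun y => -c * heatPoly c z q₂ q₃ q₄ 0 0 y := by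
      funext y; rw [hu, pd_et_heatPoly]
    rw [h1, pd_const_mul _ (contDiff_heatPoly ..).contDiffAt, pd_et_heatPoly, heatPoly_self]
    ring
  have hev : ∀ {F : Space → ℝ}, (∀ p ∈ D, ContDiffAt ℝ ∞ F p) →
      ∀ᶠ p in 𝓝 ((z.1, z.2, u z) : Space), ContDiffAt ℝ ∞ F p := fun hF =>
    eventually_of_mem (h.isOpen.mem_nhds (by rwa [hpz])) hF
  have hT := hev h.smooth_T
  have hX := hev h.smooth_X
  have hW := hev h.smooth_W
  have hu' : ∀ᶠ y in 𝓝 z, ContDiffAt ℝ ∞ u y := Eventually.of_forall fun y => hus.contDiffAt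
  have hgr : ∀ {F : Space → ℝ}, (∀ᶠ p in 𝓝 ((z.1, z.2, u z) : Space), ContDiffAt ℝ ∞ F p) →
      pd et (fun y => F (y.1, y.2, u y)) z = pd e₁ F (t, x, u₀) + pd e₃ F (t, x, u₀) * (-c * q₂) ∧
      pd ex (fun y => F (y.1, y.2, u y)) z = pd e₂ F (t, x, u₀) + pd e₃ F (t, x, u₀) * q := by
    intro F hF
    rw [pd_graph_et hF.self_of_nhds hus.contDiffAt, pd_graph_ex hF.self_of_nhds hus.contDiffAt,
      hpz, ut, ux]
    exact ⟨rfl, rfl⟩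
  have hsm : ∀ {F : Space → ℝ}, (∀ᶠ p in 𝓝 ((z.1, z.2, u z) : Space), ContDiffAt ℝ ∞ F p) →
      ∀ᶠ y in 𝓝 z, ContDiffAt ℝ ∞ (fun y : Base => F (y.1, y.2, u y)) y := by
    intro F hF
    have hc : ContDiff ℝ ∞ (fun y : Base => ((y.1, y.2, u y) : Space)) := by fun_prop
    filter_upwards [hc.continuous.continuousAt.eventually hF] with y hy
    exact ContDiffAt.comp y (f := fun y : Base => ((y.1, y.2, u y) : Space)) hy hc.contDiffAt
  have h2 : ∀ {F : Space → ℝ}, (∀ᶠ p in 𝓝 ((z.1, z.2, u z) : Space), ContDiffAt ℝ ∞ F p) →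
      pd et (pd et fun y => F (y.1, y.2, u y)) z
        = jet₂ F (t, x, u₀) (-c * q₂) (-c * q₂) (c ^ 2 * q₄) e₁ e₁ ∧
      pd et (pd ex fun y => F (y.1, y.2, u y)) z
        = jet₂ F (t, x, u₀) (-c * q₂) q (-c * q₃) e₁ e₂ ∧
      pd ex (pd ex fun y => F (y.1, y.2, u y)) z
        = jet₂ F (t, x, u₀) q q q₂ e₂ e₂ := by
    intro F hF
    rw [pd_pd_graph hF hu', pd_pd_graph hF hu', pd_pd_graph hF hu', hpz, ut, ux, uxx, utx, utt]
    simp [jet₂, et, ex]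
  obtain ⟨w, hw1, hw2, hw3⟩ := h.maps z u (by rwa [hpz]) hus (fun _ => heatOp_heatPoly ..) (by
    rw [(hgr hT).1, (hgr hT).2, (hgr hX).1, (hgr hX).2]; exact hJ)
  have ha := hsm hT
  have hb := hsm hX
  set a : Base → ℝ := fun y => T (y.1, y.2, u y) with ha'
  set b : Base → ℝ := fun y => X (y.1, y.2, u y) with hb'
  have hg1 : ∀ e, pd e (fun y => W (y.1, y.2, u y)) z
      = pd et w (a z, b z) * pd e a z + pd ex w (a z, b z) * pd e b z := by
    intro e
    rw [← pd_comp_base hw1.self_of_nhds ha.self_of_nhds hb.self_of_nhds]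
    exact pd_congr (hw3.mono fun y hy => hy.symm)
  have hg2 := fun e e' => pd_pd_comp_base (e := e) (e' := e') hw1 ha hb hw3
  refine ⟨pd et w (a z, b z), pd ex w (a z, b z), pd et (pd et w) (a z, b z),
    pd et (pd ex w) (a z, b z), pd ex (pd ex w) (a z, b z), hw2, ?_, ?_, ?_⟩
  · rw [← (hgr hW).1, ← (hgr hT).1, ← (hgr hX).1]; exact hg1 et
  · rw [← (hgr hW).2, ← (hgr hT).2, ← (hgr hX).2]; exact hg1 ex
  · rintro r s rs i j (⟨rfl, rfl, rfl, rfl, rfl⟩ | ⟨rfl, rfl, rfl, rfl, rfl⟩ |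
      ⟨rfl, rfl, rfl, rfl, rfl⟩)
    · rw [← (h2 hW).1, ← (h2 hT).1, ← (h2 hX).1, ← (hgr hT).1, ← (hgr hX).1]
      exact hg2 et et
    · rw [← (h2 hW).2.1, ← (h2 hT).2.1, ← (h2 hX).2.1, ← (hgr hT).1, ← (hgr hX).1, ← (hgr hT).2,
        ← (hgr hX).2]
      exact hg2 et ex
    · rw [← (h2 hW).2.2, ← (h2 hT).2.2, ← (h2 hX).2.2, ← (hgr hT).2, ← (hgr hX).2]
      exact hg2 ex ex

/-! ### The determining equations -/

namespace IsHeatMap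

variable {c c' : ℝ} {D : Set Space} {T X W : Space → ℝ} {p : Space}

/-- The total derivative of `T` with respect to `x` vanishes on nondegenerate jets. Two solutions with
the same jet except for `u_tt` are compared: their images have the same first derivatives, hence by
the second equation the same second derivative in the new `x`, which depends on `u_tt`
unless the total derivative is zero. -/
theorem total_dx_T_eq_zero (h : IsHeatMap c c' D T X W) (hc : c ≠ 0) (hc' : c' ≠ 0) (hp : p ∈ D)
    {q s : ℝ} (hJ : (pd e₁ T p + pd e₃ T p * s) * (pd e₂ X p + pd e₃ X p * q)
      - (pd e₂ T p + pd e₃ T p * q) * (pd e₁ X p + pd e₃ X p * s) ≠ 0) :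
    pd e₂ T p + pd e₃ T p * q = 0 := by
  obtain ⟨q₂, rfl⟩ : ∃ q₂, s = -c * q₂ := ⟨-s / c, by field_simp⟩
  obtain ⟨wa, wb, waa, wab, wbb, h0, h1, h2, h3⟩ := h.jet hp q q₂ 0 0 hJ
  obtain ⟨va, vb, vaa, vab, vbb, k0, k1, k2, k3⟩ := h.jet hp q q₂ 0 (1 / c ^ 2) hJ
  have h4 := h3 _ _ _ _ _ (Or.inl ⟨rfl, rfl, rfl, rfl, rfl⟩)
  have h5 := h3 _ _ _ _ _ (Or.inr (Or.inl ⟨rfl, rfl, rfl, rfl, rfl⟩))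
  have h6 := h3 _ _ _ _ _ (Or.inr (Or.inr ⟨rfl, rfl, rfl, rfl, rfl⟩))
  have k4 := k3 _ _ _ _ _ (Or.inl ⟨rfl, rfl, rfl, rfl, rfl⟩)
  have k5 := k3 _ _ _ _ _ (Or.inr (Or.inl ⟨rfl, rfl, rfl, rfl, rfl⟩))
  have k6 := k3 _ _ _ _ _ (Or.inr (Or.inr ⟨rfl, rfl, rfl, rfl, rfl⟩))
  clear h3 k3
  have hind := h.indep p hp wa wb (-1)
  rw [show c ^ 2 * (1 / c ^ 2) = 1 by field_simp] at k4
  rw [mul_zero] at h4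
  simp only [jet₂] at h4 h5 h6 k4 k5 k6
  by_contra hne
  set T₃ := pd e₃ T p
  set X₃ := pd e₃ X p
  set W₃ := pd e₃ W p
  have hat : pd e₁ T p = pd e₁ T p + T₃ * (-c * q₂) - T₃ * (-c * q₂) := by ring
  have hbt : pd e₁ X p = pd e₁ X p + X₃ * (-c * q₂) - X₃ * (-c * q₂) := by ring
  have hax : pd e₂ T p = pd e₂ T p + T₃ * q - T₃ * q := by ring
  have hbx : pd e₂ X p = pd e₂ X p + X₃ * q - X₃ * q := by ring
  have hwt : pd e₁ W p = pd e₁ W p + W₃ * (-c * q₂) - W₃ * (-c * q₂) := by ring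
  have hwx : pd e₂ W p = pd e₂ W p + W₃ * q - W₃ * q := by ring
  rw [hat, hax, hbt, hbx, hwt, hwx] at hind
  clear hat hbt hax hbx hwt hwx
  set at' := pd e₁ T p + T₃ * (-c * q₂)
  set ax := pd e₂ T p + T₃ * q
  set bt := pd e₁ X p + X₃ * (-c * q₂)
  set bx := pd e₂ X p + X₃ * q
  set wt := pd e₁ W p + W₃ * (-c * q₂)
  set wx := pd e₂ W p + W₃ * q
  -- the first derivatives of the transformed solution do not depend on `u_tt`
  have ea : va = wa := mul_right_cancel₀ hJ (by linear_combination bx * (h1 - k1) - bt * (h2 - k2))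
  have eb : vb = wb := mul_right_cancel₀ hJ (by linear_combination at' * (h2 - k2) - ax * (h1 - k1))
  subst ea eb
  have ebb : vbb = wbb := mul_left_cancel₀ hc' (by linear_combination k0 - h0)
  subst ebb
  have m1 : (vaa - waa) * ax + 2 * (vab - wab) * bx = 0 :=
    mul_left_cancel₀ hne (by linear_combination h6 - k6)
  have m2 : vab - wab = 0 := mul_right_cancel₀ hJ (by linear_combination k5 - h5 + at' * m1)
  have m3 : vaa - waa = 0 := mul_right_cancel₀ hne (by linear_combination m1 - 2 * bx * m2)
  have m4 : W₃ - va * T₃ - vb * X₃ = 0 := by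
    linear_combination k4 - h4 + at' * at' * m3 + 2 * at' * bt * m2
  have := (hind (by linear_combination -h1 + (-c * q₂) * m4) (by linear_combination -h2 + q * m4)
    (by linear_combination -m4)).2.2
  norm_num at this

/-- The new time depends on the old one only. -/
theorem T_projects (h : IsHeatMap c c' D T X W) (hc : c ≠ 0) (hc' : c' ≠ 0) (hp : p ∈ D) :
    pd e₂ T p = 0 ∧ pd e₃ T p = 0 := by
  have h1 : ∀ q s : ℝ, (pd e₂ T p + pd e₃ T p * q) *
      ((pd e₁ T p + pd e₃ T p * s) * (pd e₂ X p + pd e₃ X p * q)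
        - (pd e₂ T p + pd e₃ T p * q) * (pd e₁ X p + pd e₃ X p * s)) = 0 := by
    intro q s
    by_cases hJ : (pd e₁ T p + pd e₃ T p * s) * (pd e₂ X p + pd e₃ X p * q)
        - (pd e₂ T p + pd e₃ T p * q) * (pd e₁ X p + pd e₃ X p * s) = 0
    · rw [hJ, mul_zero]
    · rw [h.total_dx_T_eq_zero hc hc' hp hJ, zero_mul]
  have hind := h.indep p hp
  set T₁ := pd e₁ T p
  set T₂ := pd e₂ T p
  set T₃ := pd e₃ T p
  set X₁ := pd e₁ X p
  set X₂ := pd e₂ X p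
  set X₃ := pd e₃ X p
  -- the 2x2 minors of the first two rows of the Jacobian matrix are not all zero
  have hm : ¬(T₁ * X₂ - T₂ * X₁ = 0 ∧ T₃ * X₂ - T₂ * X₃ = 0 ∧ T₁ * X₃ - T₃ * X₁ = 0) := by
    rintro ⟨m0, m1, m2⟩
    have a1 := hind X₁ (-T₁) 0 (by ring) (by linear_combination -m0) (by linear_combination -m2)
    have a2 := hind X₂ (-T₂) 0 (by linear_combination m0) (by ring) (by linear_combination m1)
    have a3 := hind X₃ (-T₃) 0 (by linear_combination m2) (by linear_combination -m1) (by ring)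
    have := (hind 1 0 0 (by linear_combination -a1.2.1) (by linear_combination -a2.2.1)
      (by linear_combination -a3.2.1)).1
    norm_num at this
  -- comparison of the coefficients of the polynomial in `q`, `s`
  have c00 := h1 0 0
  have c01 := h1 0 1
  have c10 := h1 1 0
  have cm0 := h1 (-1) 0
  have c11 := h1 1 1
  have d1 : T₂ * (T₁ * X₂ - T₂ * X₁) = 0 := by linear_combination c00
  have d2 : T₂ * (T₃ * X₂ - T₂ * X₃) = 0 := by linear_combination c01 - c00
  have d3 : T₃ * (T₁ * X₃ - T₃ * X₁) = 0 := by linear_combination (c10 + cm0) / 2 - c00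
  have d4 : T₂ * (T₁ * X₃ - T₃ * X₁) + T₃ * (T₁ * X₂ - T₂ * X₁) = 0 := by
    linear_combination (c10 - cm0) / 2
  have d5 : T₃ * (T₃ * X₂ - T₂ * X₃) = 0 := by linear_combination c11 - c10 - d2
  have hT3 : T₃ = 0 := by
    by_contra h3
    have f2 := (mul_eq_zero.1 d5).resolve_left h3
    have f3 := (mul_eq_zero.1 d3).resolve_left h3
    have f1 := (mul_eq_zero.1 (show T₃ * (T₁ * X₂ - T₂ * X₁) = 0 by
      linear_combination d4 - T₂ * f3)).resolve_left h3
    exact hm ⟨f1, f2, f3⟩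
  refine ⟨?_, hT3⟩
  by_contra h2
  refine hm ⟨(mul_eq_zero.1 d1).resolve_left h2, (mul_eq_zero.1 d2).resolve_left h2,
    (mul_eq_zero.1 (show T₂ * (T₁ * X₃ - T₃ * X₁) = 0 by
      rw [hT3] at d4 ⊢; linear_combination d4)).resolve_left h2⟩

theorem T_t_ne_zero (h : IsHeatMap c c' D T X W) (hc : c ≠ 0) (hc' : c' ≠ 0) (hp : p ∈ D) :
    pd e₁ T p ≠ 0 := by
  intro h0
  obtain ⟨h1, h2⟩ := h.T_projects hc hc' hp
  have := (h.indep p hp 1 0 0 (by simp [h0]) (by simp [h1]) (by simp [h2])).1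
  norm_num at this

/-- The condition that a solution of the first equation is transformed to a solution of the second
one, once the new time is known to depend on the old one only; `q` and `q₂` are the values of `u_x`
and `u_xx`. -/
theorem transformed_equation (h : IsHeatMap c c' D T X W) (hc : c ≠ 0) (hc' : c' ≠ 0)
    (hp : p ∈ D) (q q₂ : ℝ) (hb : pd e₂ X p + pd e₃ X p * q ≠ 0) :
    (pd e₂ X p + pd e₃ X p * q) ^ 2 *
        ((pd e₁ W p + pd e₃ W p * (-c * q₂)) * (pd e₂ X p + pd e₃ X p * q)
          - (pd e₂ W p + pd e₃ W p * q) * (pd e₁ X p + pd e₃ X p * (-c * q₂)))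
      + c' * pd e₁ T p * (jet₂ W p q q q₂ e₂ e₂ * (pd e₂ X p + pd e₃ X p * q)
          - (pd e₂ W p + pd e₃ W p * q) * jet₂ X p q q q₂ e₂ e₂) = 0 := by
  obtain ⟨hT2, hT3⟩ := h.T_projects hc hc' hp
  have hT1 := h.T_t_ne_zero hc hc' hp
  have hz : ∀ i, pd i (pd e₂ T) p = 0 ∧ pd i (pd e₃ T) p = 0 := fun i =>
    ⟨pd_eq_zero_on h.isOpen (fun r hr => (h.T_projects hc hc' hr).1) hp,
      pd_eq_zero_on h.isOpen (fun r hr => (h.T_projects hc hc' hr).2) hp⟩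
  obtain ⟨wa, wb, waa, wab, wbb, h0, h1, h2, h3⟩ := h.jet hp q q₂ 0 0 (by
    rw [hT2, hT3]; simpa using ⟨hT1, hb⟩)
  have h6 := h3 _ _ _ _ _ (Or.inr (Or.inr ⟨rfl, rfl, rfl, rfl, rfl⟩))
  have hTj : jet₂ T p q q q₂ e₂ e₂ = 0 := by
    simp [jet₂, (hz e₂).1, (hz e₂).2, (hz e₃).1, (hz e₃).2, hT3]
  rw [hTj, hT2, hT3] at h6
  rw [hT3] at h1
  rw [hT2, hT3] at h2
  rw [h6, h1, h2]
  linear_combination (pd e₂ X p + pd e₃ X p * q) ^ 3 * pd e₁ T p * h0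

/-- The new `x` does not depend on `u`, and it is scaled with the square root of the time scale; this
is the coefficient of `u_xx` in the transformed equation. -/
theorem X_projects (h : IsHeatMap c c' D T X W) (hc : c ≠ 0) (hc' : c' ≠ 0) (hp : p ∈ D) :
    pd e₃ X p = 0 ∧ c * pd e₂ X p ^ 2 = c' * pd e₁ T p := by
  obtain ⟨hT2, hT3⟩ := h.T_projects hc hc' hp
  have hT1 := h.T_t_ne_zero hc hc' hp
  have hind := h.indep p hp
  have hK : pd e₃ W p * pd e₂ X p - pd e₂ W p * pd e₃ X p ≠ 0 := by
    intro hK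
    rw [hT2, hT3] at hind
    have a3 := hind (-(pd e₃ W p * pd e₁ X p - pd e₁ W p * pd e₃ X p) / pd e₁ T p)
      (pd e₃ W p) (-pd e₃ X p) (by field_simp; ring) (by linear_combination hK) (by ring)
    have a2 := hind (-(pd e₂ W p * pd e₁ X p - pd e₁ W p * pd e₂ X p) / pd e₁ T p)
      (pd e₂ W p) (-pd e₂ X p) (by field_simp; ring) (by ring) (by linear_combination -hK)
    have a1 := (hind (-pd e₁ X p / pd e₁ T p) 1 0 (by field_simp; ring)
      (by linear_combination -a2.2.2) (by linear_combination -a3.2.2)).2.1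
    norm_num at a1
  have key : ∀ q : ℝ, pd e₂ X p + pd e₃ X p * q ≠ 0 →
      c * (pd e₂ X p + pd e₃ X p * q) ^ 2 = c' * pd e₁ T p := by
    intro q hb
    have m0 := h.transformed_equation hc hc' hp q 0 hb
    have m1 := h.transformed_equation hc hc' hp q 1 hb
    simp only [jet₂] at m0 m1
    refine mul_right_cancel₀ hK ?_
    linear_combination m0 - m1
  have h3 : pd e₃ X p = 0 := by
    by_contra h3
    -- the square of a nonconstant affine function of `q` is not constant
    have k1 := key ((1 - pd e₂ X p) / pd e₃ X p) (by field_simp; norm_num)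
    have k2 := key ((2 - pd e₂ X p) / pd e₃ X p) (by field_simp; norm_num)
    field_simp at k1 k2
    exact hc (by linarith)
  refine ⟨h3, ?_⟩
  have h2 : pd e₂ X p ≠ 0 := by
    intro h2; rw [h2, h3] at hK; simp at hK
  have := key 0 (by rw [h3]; simpa using h2)
  simpa using this

theorem X_x_ne_zero (h : IsHeatMap c c' D T X W) (hc : c ≠ 0) (hc' : c' ≠ 0) (hp : p ∈ D) :
    pd e₂ X p ≠ 0 := by
  intro h0
  have h1 := (h.X_projects hc hc' hp).2
  rw [h0] at h1
  have := mul_ne_zero hc' (h.T_t_ne_zero hc hc' hp)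
  apply this
  rw [← h1]; ring

theorem X_xx_eq_zero (h : IsHeatMap c c' D T X W) (hc : c ≠ 0) (hc' : c' ≠ 0) (hp : p ∈ D) :
    pd e₂ (pd e₂ X) p = 0 := by
  have h1 : pd e₂ (fun r => c * (pd e₂ X r * pd e₂ X r)) p = pd e₂ (fun r => c' * pd e₁ T r) p :=
    pd_congr_on h.isOpen (fun r hr => by rw [← (h.X_projects hc hc' hr).2]; ring) hp
  have hX := contDiffAt_pd e₂ (h.smooth_X p hp)
  have hT := contDiffAt_pd e₁ (h.smooth_T p hp)
  rw [pd_const_mul _ (hX.mul hX), pd_mul hX hX, pd_const_mul _ hT,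
    pd_comm (e := e₂) (h.smooth_T p hp),
    pd_eq_zero_on h.isOpen (fun r hr => (h.T_projects hc hc' hr).1) hp] at h1
  have hx := h.X_x_ne_zero hc hc' hp
  have : 2 * c * pd e₂ X p ≠ 0 := by positivity
  exact mul_left_cancel₀ this (by linear_combination h1)

/-- The determining equations for the last component: the coefficients of the powers of `u_x` in the
transformed equation. -/
theorem W_equations (h : IsHeatMap c c' D T X W) (hc : c ≠ 0) (hc' : c' ≠ 0) (hp : p ∈ D) :
    pd e₃ W p ≠ 0 ∧ pd e₃ (pd e₃ W) p = 0 ∧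
      2 * c * pd e₂ X p * pd e₂ (pd e₃ W) p = pd e₁ X p * pd e₃ W p ∧
      pd e₂ X p * (pd e₁ W p + c * pd e₂ (pd e₂ W) p) = pd e₁ X p * pd e₂ W p := by
  obtain ⟨hX3, hX2⟩ := h.X_projects hc hc' hp
  have hx := h.X_x_ne_zero hc hc' hp
  obtain ⟨hT2, hT3⟩ := h.T_projects hc hc' hp
  have hT1 := h.T_t_ne_zero hc hc' hp
  have hXz : ∀ i, pd i (pd e₃ X) p = 0 := fun i =>
    pd_eq_zero_on h.isOpen (fun r hr => (h.X_projects hc hc' hr).1) hp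
  have hX32 : pd e₃ (pd e₂ X) p = 0 := by rw [pd_comm (h.smooth_X p hp)]; exact hXz _
  have hW32 : pd e₃ (pd e₂ W) p = pd e₂ (pd e₃ W) p := pd_comm (h.smooth_W p hp)
  have hXj : ∀ q, jet₂ X p q q 0 e₂ e₂ = 0 := by
    intro q
    simp [jet₂, hXz, hX32, h.X_xx_eq_zero hc hc' hp]
  have key : ∀ q : ℝ, pd e₂ X p * pd e₁ W p - (pd e₂ W p + pd e₃ W p * q) * pd e₁ X p
      + c * pd e₂ X p * (pd e₂ (pd e₂ W) p + 2 * pd e₂ (pd e₃ W) p * q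
        + pd e₃ (pd e₃ W) p * q ^ 2) = 0 := by
    intro q
    have m := h.transformed_equation hc hc' hp q 0 (by rw [hX3]; simpa using hx)
    rw [hXj, hX3, ← hX2] at m
    simp only [jet₂, hW32] at m
    exact mul_left_cancel₀ (pow_ne_zero 2 hx) (by linear_combination m)
  have k0 := key 0
  have k1 := key 1
  have k2 := key (-1)
  refine ⟨?_, ?_, ?_, ?_⟩
  · intro h3
    have := h.indep p hp ((-pd e₁ W p + pd e₂ W p / pd e₂ X p * pd e₁ X p) / pd e₁ T p)
      (-pd e₂ W p / pd e₂ X p) 1 (by field_simp; ring) (by rw [hT2]; field_simp; ring)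
      (by rw [h3, hX3, hT3]; ring)
    exact one_ne_zero this.2.2
  · have : 2 * c * pd e₂ X p ≠ 0 := by positivity
    exact mul_left_cancel₀ this (by linear_combination k1 + k2 - 2 * k0)
  · linear_combination (k1 - k2) / 2
  · linear_combination k0

end IsHeatMap

/-! ### The factor `F¹` -/

theorem pd_proj {H : Base → ℝ} {p e : Space} (hH : ContDiffAt ℝ ∞ H (p.1, p.2.1)) :
    pd e (fun q : Space => H (q.1, q.2.1)) p
      = pd et H (p.1, p.2.1) * e.1 + pd ex H (p.1, p.2.1) * e.2.1 := by
  have h1 : HasFDerivAt (fun q : Space => ((q.1, q.2.1) : Base)) _ p :=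
    (hasFDerivAt_fst (𝕜 := ℝ) (p := p)).prodMk
      ((hasFDerivAt_fst (𝕜 := ℝ) (p := p.2)).comp p (hasFDerivAt_snd (𝕜 := ℝ) (p := p)))
  have h2 := ((differentiableAt_of_smooth hH).hasFDerivAt.comp p h1).fderiv
  rw [show pd e (fun q : Space => H (q.1, q.2.1)) p
    = fderiv ℝ (H ∘ fun q : Space => ((q.1, q.2.1) : Base)) p e from rfl, h2,
    ContinuousLinearMap.comp_apply, fderiv_base]
  simp

theorem contDiffAt_proj {H : Base → ℝ} {p : Space} (hH : ContDiffAt ℝ ∞ H (p.1, p.2.1)) :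
    ContDiffAt ℝ ∞ (fun q : Space => H (q.1, q.2.1)) p :=
  ContDiffAt.comp p (f := fun q : Space => ((q.1, q.2.1) : Base)) hH (by fun_prop)

/-- The ratio `X_t / X_x` for the `x`-component `X` of the explicit transformation. -/
def Params.drift (P : Params) (z : Base) : ℝ :=
  (P.μ₁ * P.δ - P.γ * P.μ₀ - P.γ * z.2) / (P.γ * z.1 + P.δ)

namespace Params

variable (P : Params) {c : ℝ} {z : Base}

theorem contDiffAt_F1 (hc : c ≠ 0) (hz : P.γ * z.1 + P.δ ≠ 0) :
    ContDiffAt ℝ ∞ (fun y : Base => P.F1 c y.1 y.2) z := by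
  unfold F1
  split_ifs with hγ
  · fun_prop
  · have : ContDiffAt ℝ ∞ (fun y : Base => |P.γ * y.1 + P.δ|) z :=
      (contDiffAt_abs hz).comp z (f := fun y : Base => P.γ * y.1 + P.δ) (by fun_prop)
    have h2 := this.sqrt (abs_ne_zero.2 hz)
    have h3 : 4 * c * P.γ * (P.γ * z.1 + P.δ) ≠ 0 := by positivity
    exact (contDiffAt_const.mul h2).mul
      (ContDiffAt.exp (ContDiffAt.neg (ContDiffAt.div (by fun_prop) (by fun_prop) h3)))

theorem F1_ne_zero (hk : P.k ≠ 0) (hz : P.γ * z.1 + P.δ ≠ 0) : P.F1 c z.1 z.2 ≠ 0 := by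
  unfold F1
  split_ifs with hγ
  · positivity
  · have : √|P.γ * z.1 + P.δ| ≠ 0 := by positivity
    positivity

theorem pd_ex_F1 (hc : c ≠ 0) (hz : P.γ * z.1 + P.δ ≠ 0) :
    pd ex (fun y : Base => P.F1 c y.1 y.2) z = P.drift z / (2 * c) * P.F1 c z.1 z.2 := by
  obtain ⟨t, x⟩ := z
  refine pd_ex_of_hasDerivAt (P.contDiffAt_F1 hc hz) ?_
  have hx := hasDerivAt_id x
  simp only [F1, drift] at hz ⊢
  split_ifs with hγ
  · have := ((((hx.const_mul (2 * P.μ₁)).add_const (P.μ₁ ^ 2 * t)).div_const (4 * c)).exp).const_mul P.k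
    refine this.congr_deriv ?_
    have : P.δ ≠ 0 := by simpa [hγ] using hz
    simp [hγ]
    field_simp
    ring
  · have := ((((((hx.const_mul P.γ).sub_const (P.μ₁ * P.δ)).add_const (P.μ₀ * P.γ)).pow 2).div_const
      (4 * c * P.γ * (P.γ * t + P.δ))).neg.exp).const_mul (P.k * √|P.γ * t + P.δ|)
    refine this.congr_deriv ?_
    simp
    field_simp
    ring

theorem pd_et_F1 (hc : c ≠ 0) (hz : P.γ * z.1 + P.δ ≠ 0) :
    pd et (fun y : Base => P.F1 c y.1 y.2) z
      = (P.drift z ^ 2 / (4 * c) + P.γ / (2 * (P.γ * z.1 + P.δ))) * P.F1 c z.1 z.2 := by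
  obtain ⟨t, x⟩ := z
  refine pd_et_of_hasDerivAt (P.contDiffAt_F1 hc hz) ?_
  have ht := hasDerivAt_id t
  simp only [F1, drift] at hz ⊢
  split_ifs with hγ
  · have := ((((ht.const_mul (P.μ₁ ^ 2)).const_add (2 * P.μ₁ * x)).div_const (4 * c)).exp).const_mul P.k
    refine this.congr_deriv ?_
    have : P.δ ≠ 0 := by simpa [hγ] using hz
    simp [hγ]
    field_simp
  · have hS : HasDerivAt (fun s => P.γ * s + P.δ) (P.γ * 1) t := (ht.const_mul P.γ).add_const P.δ
    have hsg : ((SignType.sign (P.γ * t + P.δ) : SignType) : ℝ) * (P.γ * t + P.δ)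
        = √|P.γ * t + P.δ| ^ 2 := by
      rw [sign_mul_self, Real.sq_sqrt (abs_nonneg _)]
    have hs0 : √|P.γ * t + P.δ| ≠ 0 := by positivity
    have h1 : HasDerivAt (fun s => √|P.γ * s + P.δ|)
        (P.γ / (2 * (P.γ * t + P.δ)) * √|P.γ * t + P.δ|) t := by
      have ha : HasDerivAt (fun s => |P.γ * s + P.δ|) _ t :=
        HasDerivAt.comp t (h₂ := fun r : ℝ => |r|) (hasDerivAt_abs hz) hS
      refine (ha.sqrt (abs_ne_zero.2 hz)).congr_deriv ?_
      field_simp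
      linear_combination hsg
    have h2 : HasDerivAt (fun s => Real.exp (-((P.γ * x - P.μ₁ * P.δ + P.μ₀ * P.γ) ^ 2
        / (4 * c * P.γ * (P.γ * s + P.δ))))) _ t :=
      (((hasDerivAt_const t ((P.γ * x - P.μ₁ * P.δ + P.μ₀ * P.γ) ^ 2)).fun_div
        (hS.const_mul (4 * c * P.γ)) (by positivity)).fun_neg).exp
    refine ((h1.const_mul P.k).mul h2).congr_deriv ?_
    generalize Real.exp _ = r
    field_simp
    ring

end Params

/-! ### Functions on connected sets with vanishing derivatives -/

theorem pd_fst (e p : Space) : pd e (fun q : Space => q.1) p = e.1 := by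
  simp [pd, fderiv_fst]

theorem pd_snd_fst (e p : Space) : pd e (fun q : Space => q.2.1) p = e.2.1 := by
  have := ((hasFDerivAt_fst (𝕜 := ℝ) (p := p.2)).comp p (hasFDerivAt_snd (𝕜 := ℝ) (p := p))).fderiv
  rw [show pd e (fun q : Space => q.2.1) p = fderiv ℝ (Prod.fst ∘ Prod.snd) p e from rfl, this]
  simp

theorem pd_snd_snd (e p : Space) : pd e (fun q : Space => q.2.2) p = e.2.2 := by
  have := ((hasFDerivAt_snd (𝕜 := ℝ) (p := p.2)).comp p (hasFDerivAt_snd (𝕜 := ℝ) (p := p))).fderiv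
  rw [show pd e (fun q : Space => q.2.2) p = fderiv ℝ (Prod.snd ∘ Prod.snd) p e from rfl, this]
  simp

theorem exists_eq_const {U : Set Space} (hU : IsOpen U) (hc : IsPreconnected U) {F : Space → ℝ}
    (hF : ∀ p ∈ U, ContDiffAt ℝ ∞ F p) (h1 : ∀ p ∈ U, pd e₁ F p = 0) (h2 : ∀ p ∈ U, pd e₂ F p = 0)
    (h3 : ∀ p ∈ U, pd e₃ F p = 0) : ∃ a, ∀ p ∈ U, F p = a := by
  refine hU.exists_is_const_of_fderiv_eq_zero (𝕜 := ℝ) hc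
    (fun p hp => (differentiableAt_of_smooth (hF p hp)).differentiableWithinAt) fun p hp => ?_
  ext <;> simp [fderiv_space, h1 p hp, h2 p hp, h3 p hp]

theorem exists_eq_affine {U : Set Space} (hU : IsOpen U) (hc : IsPreconnected U) {F : Space → ℝ}
    (hF : ∀ p ∈ U, ContDiffAt ℝ ∞ F p) (h1 : ∀ p ∈ U, pd e₁ (pd e₁ F) p = 0)
    (h2 : ∀ p ∈ U, pd e₂ F p = 0) (h3 : ∀ p ∈ U, pd e₃ F p = 0) :
    ∃ a b, ∀ p ∈ U, F p = a * p.1 + b := by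
  obtain ⟨a, ha⟩ := exists_eq_const hU hc (fun p hp => contDiffAt_pd e₁ (hF p hp)) h1
    (fun p hp => by rw [pd_comm (hF p hp)]; exact pd_eq_zero_on hU h2 hp)
    (fun p hp => by rw [pd_comm (hF p hp)]; exact pd_eq_zero_on hU h3 hp)
  have hl : ∀ p e : Space, pd e (fun q : Space => a * q.1) p = a * e.1 := fun p e => by
    rw [pd_const_mul _ contDiffAt_fst, pd_fst]
  have hs : ∀ p : Space, ContDiffAt ℝ ∞ (fun q : Space => a * q.1) p := fun p => by fun_prop
  obtain ⟨b, hb⟩ := exists_eq_const (F := fun q => F q - a * q.1) hU hc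
    (fun p hp => (hF p hp).sub (hs p))
    (fun p hp => by rw [pd_sub (hF p hp) (hs p), hl, ha p hp]; simp [e₁])
    (fun p hp => by rw [pd_sub (hF p hp) (hs p), hl, h2 p hp]; simp [e₂])
    (fun p hp => by rw [pd_sub (hF p hp) (hs p), hl, h3 p hp]; simp [e₃])
  exact ⟨a, b, fun p hp => by linear_combination hb p hp⟩

/-! ### Integration of the determining equations -/

namespace IsHeatMap

variable {c c' : ℝ} {U : Set Space} {T X W : Space → ℝ}

/-- The ratio `X_t / X_x` satisfies the inviscid Burgers equation and is affine in `x`, and the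
coefficient `W_u` of the last component is found from it. -/
theorem drift_equations (h : IsHeatMap c c' U T X W) (hc : c ≠ 0) (hc' : c' ≠ 0) :
    ∃ ρ : Space → ℝ, (∀ p ∈ U, ContDiffAt ℝ ∞ ρ p) ∧ ∀ p ∈ U,
      pd e₁ X p = ρ p * pd e₂ X p ∧ pd e₃ ρ p = 0 ∧
      pd e₁ (pd e₂ X) p = pd e₂ ρ p * pd e₂ X p ∧
      pd e₂ (pd e₂ ρ) p = 0 ∧ pd e₁ ρ p = ρ p * pd e₂ ρ p ∧
      pd e₂ (pd e₃ W) p = ρ p / (2 * c) * pd e₃ W p ∧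
      pd e₁ (pd e₃ W) p = (ρ p ^ 2 / (4 * c) - pd e₂ ρ p / 2) * pd e₃ W p := by
  have hX := h.smooth_X
  have hX2 : ∀ p ∈ U, ContDiffAt ℝ ∞ (pd e₂ X) p := fun p hp => contDiffAt_pd e₂ (hX p hp)
  have hX1 : ∀ p ∈ U, ContDiffAt ℝ ∞ (pd e₁ X) p := fun p hp => contDiffAt_pd e₁ (hX p hp)
  have hA : ∀ p ∈ U, ContDiffAt ℝ ∞ (pd e₃ W) p := fun p hp => contDiffAt_pd e₃ (h.smooth_W p hp)
  have hx : ∀ p ∈ U, pd e₂ X p ≠ 0 := fun p hp => h.X_x_ne_zero hc hc' hp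
  have hX3 : ∀ p ∈ U, pd e₃ X p = 0 := fun p hp => (h.X_projects hc hc' hp).1
  have hXx3 : ∀ p ∈ U, pd e₃ (pd e₂ X) p = 0 := fun p hp => by
    rw [pd_comm (hX p hp)]; exact pd_eq_zero_on h.isOpen hX3 hp
  have hXt3 : ∀ p ∈ U, pd e₃ (pd e₁ X) p = 0 := fun p hp => by
    rw [pd_comm (hX p hp)]; exact pd_eq_zero_on h.isOpen hX3 hp
  have hXxx : ∀ p ∈ U, pd e₂ (pd e₂ X) p = 0 := fun p hp => h.X_xx_eq_zero hc hc' hp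
  set ρ : Space → ℝ := fun q => pd e₁ X q / pd e₂ X q with hρd
  have hρ : ∀ p ∈ U, ContDiffAt ℝ ∞ ρ p := fun p hp => (hX1 p hp).div (hX2 p hp) (hx p hp)
  have hρe : ∀ p ∈ U, ∀ e, pd e ρ p
      = (pd e (pd e₁ X) p * pd e₂ X p - pd e₁ X p * pd e (pd e₂ X) p) / pd e₂ X p ^ 2 :=
    fun p hp e => pd_div (hX1 p hp) (hX2 p hp) (hx p hp)
  have r1 : ∀ p ∈ U, pd e₁ X p = ρ p * pd e₂ X p := fun p hp =>
    (div_mul_cancel₀ _ (hx p hp)).symm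
  have r3 : ∀ p ∈ U, pd e₃ ρ p = 0 := fun p hp => by
    rw [hρe p hp, hXt3 p hp, hXx3 p hp]; simp
  have r2 : ∀ p ∈ U, pd e₁ (pd e₂ X) p = pd e₂ ρ p * pd e₂ X p := fun p hp => by
    have := hx p hp
    rw [hρe p hp, hXxx p hp, pd_comm (e := e₂) (hX p hp)]; field_simp; ring
  have hp2 : ∀ p ∈ U, pd e₂ (pd e₂ ρ) p = 0 := fun p hp => by
    have e1 := pd_congr_on (e := e₂) h.isOpen r2 hp
    rw [pd_mul (contDiffAt_pd e₂ (hρ p hp)) (hX2 p hp), hXxx p hp, pd_comm (hX2 p hp),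
      pd_eq_zero_on h.isOpen hXxx hp] at e1
    have := hx p hp
    exact (mul_eq_zero.1 (by linear_combination -e1)).resolve_right this
  have a2 : ∀ p ∈ U, pd e₂ (pd e₃ W) p = ρ p / (2 * c) * pd e₃ W p := fun p hp => by
    have e1 := (h.W_equations hc hc' hp).2.2.1
    rw [r1 p hp] at e1
    have := hx p hp
    field_simp
    exact mul_left_cancel₀ this (by linear_combination e1)
  have a3 : ∀ p ∈ U, pd e₃ (pd e₃ W) p = 0 := fun p hp => (h.W_equations hc hc' hp).2.1
  have hA0 : ∀ p ∈ U, pd e₃ W p ≠ 0 := fun p hp => (h.W_equations hc hc' hp).1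
  -- the equation for `W_u` is obtained by differentiating the one for `W`
  have a4 : ∀ p ∈ U, pd e₁ (pd e₃ W) p + c * pd e₂ (pd e₂ (pd e₃ W)) p
      = ρ p * pd e₂ (pd e₃ W) p := fun p hp => by
    have hW := h.smooth_W p hp
    have hWt := contDiffAt_pd e₁ hW
    have hWx := contDiffAt_pd e₂ hW
    have hWxx := contDiffAt_pd e₂ hWx
    have e0 : ∀ q ∈ U, pd e₁ W q + c * pd e₂ (pd e₂ W) q = ρ q * pd e₂ W q := fun q hq => by
      have e1 := (h.W_equations hc hc' hq).2.2.2
      rw [r1 q hq] at e1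
      exact mul_left_cancel₀ (hx q hq) (by linear_combination e1)
    have e1 := pd_congr_on (e := e₃) h.isOpen e0 hp
    have e2 : pd e₃ (pd e₂ (pd e₂ W)) p = pd e₂ (pd e₂ (pd e₃ W)) p := by
      rw [pd_comm hWx]
      exact pd_congr_on h.isOpen (fun q hq => pd_comm (h.smooth_W q hq)) hp
    rw [pd_add hWt (contDiffAt_const.mul hWxx), pd_const_mul _ hWxx, pd_mul (hρ p hp) hWx,
      r3 p hp, e2, pd_comm hW, pd_comm (e := e₃) (e' := e₂) hW] at e1
    linear_combination e1
  have a1 : ∀ p ∈ U, pd e₁ (pd e₃ W) p = (ρ p ^ 2 / (4 * c) - pd e₂ ρ p / 2) * pd e₃ W p :=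
    fun p hp => by
    have e1 : pd e₂ (pd e₂ (pd e₃ W)) p = pd e₂ (fun q => (1 / (2 * c)) * (ρ q * pd e₃ W q)) p :=
      pd_congr_on h.isOpen (fun q hq => by rw [a2 q hq]; ring) hp
    rw [pd_const_mul _ ((hρ p hp).mul (hA p hp)), pd_mul (hρ p hp) (hA p hp)] at e1
    have e2 := a4 p hp
    rw [e1, a2 p hp] at e2
    rw [eq_sub_of_add_eq e2]
    field_simp
    ring
  refine ⟨ρ, hρ, fun p hp => ⟨r1 p hp, r3 p hp, r2 p hp, hp2 p hp, ?_, a2 p hp, a1 p hp⟩⟩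
  -- cross differentiation of the two equations for `W_u`
  have hr := hρ p hp
  have hr2 := contDiffAt_pd e₂ hr
  have ha := hA p hp
  have c1 : pd e₁ (pd e₂ (pd e₃ W)) p = pd e₁ (fun q => (1 / (2 * c)) * (ρ q * pd e₃ W q)) p :=
    pd_congr_on h.isOpen (fun q hq => by rw [a2 q hq]; ring) hp
  have c2 : pd e₂ (pd e₁ (pd e₃ W)) p
      = pd e₂ (fun q => ((1 / (4 * c)) * (ρ q * ρ q) - (1 / 2) * pd e₂ ρ q) * pd e₃ W q) p :=
    pd_congr_on h.isOpen (fun q hq => by rw [a1 q hq]; ring) hp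
  rw [pd_comm ha, c2, pd_const_mul _ (hr.mul ha), pd_mul hr ha,
    pd_mul ((contDiffAt_const.mul (hr.mul hr)).sub (contDiffAt_const.mul hr2)) ha,
    pd_sub (contDiffAt_const.mul (hr.mul hr)) (contDiffAt_const.mul hr2),
    pd_const_mul _ (hr.mul hr), pd_const_mul _ hr2, pd_mul hr hr, hp2 p hp, a1 p hp, a2 p hp] at c1
  have hne : pd e₃ W p / (2 * c) ≠ 0 := div_ne_zero (hA0 p hp) (by positivity)
  refine mul_left_cancel₀ hne ?_
  linear_combination -c1

/-- The explicit form of the components `T` and `X`; the tuple of parameters is normalized by the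
condition `κ = 1`. -/
theorem exists_fractional_linear (h : IsHeatMap c c' U T X W) (hc : c ≠ 0) (hc' : c' ≠ 0)
    (hU : IsPreconnected U) (hne : U.Nonempty) :
    ∃ α β γ δ μ₁ μ₀ : ℝ, α * δ - β * γ = c / c' ∧ ∀ p ∈ U,
      γ * p.1 + δ ≠ 0 ∧ T p = (α * p.1 + β) / (γ * p.1 + δ) ∧
      X p = (p.2.1 + μ₁ * p.1 + μ₀) / (γ * p.1 + δ) ∧
      pd e₂ (pd e₃ W) p
        = (μ₁ * δ - γ * μ₀ - γ * p.2.1) / (γ * p.1 + δ) / (2 * c) * pd e₃ W p ∧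
      pd e₁ (pd e₃ W) p
        = (((μ₁ * δ - γ * μ₀ - γ * p.2.1) / (γ * p.1 + δ)) ^ 2 / (4 * c)
          + γ / (2 * (γ * p.1 + δ))) * pd e₃ W p := by
  obtain ⟨ρ, hρ, hr⟩ := h.drift_equations hc hc'
  have hX := h.smooth_X
  have hT := h.smooth_T
  have hX2 : ∀ p ∈ U, ContDiffAt ℝ ∞ (pd e₂ X) p := fun p hp => contDiffAt_pd e₂ (hX p hp)
  have hx : ∀ p ∈ U, pd e₂ X p ≠ 0 := fun p hp => h.X_x_ne_zero hc hc' hp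
  have hXxx : ∀ p ∈ U, pd e₂ (pd e₂ X) p = 0 := fun p hp => h.X_xx_eq_zero hc hc' hp
  have hX3 : ∀ p ∈ U, pd e₃ X p = 0 := fun p hp => (h.X_projects hc hc' hp).1
  have hXx3 : ∀ p ∈ U, pd e₃ (pd e₂ X) p = 0 := fun p hp => by
    rw [pd_comm (hX p hp)]; exact pd_eq_zero_on h.isOpen hX3 hp
  -- the denominator `σ = 1 / X_x`
  set σ : Space → ℝ := fun q => (pd e₂ X q)⁻¹ with hσd
  have hσ : ∀ p ∈ U, ContDiffAt ℝ ∞ σ p := fun p hp => (hX2 p hp).inv (hx p hp)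
  have hσ0 : ∀ p ∈ U, σ p ≠ 0 := fun p hp => inv_ne_zero (hx p hp)
  have hσx : ∀ p ∈ U, pd e₂ X p * σ p = 1 := fun p hp => mul_inv_cancel₀ (hx p hp)
  have σ1 : ∀ p ∈ U, pd e₁ σ p = -(pd e₂ ρ p * σ p) := fun p hp => by
    rw [pd_inv (hX2 p hp) (hx p hp), (hr p hp).2.2.1]
    have := hx p hp
    simp only [hσd]
    field_simp
  have σ2 : ∀ p ∈ U, pd e₂ σ p = 0 := fun p hp => by
    rw [pd_inv (hX2 p hp) (hx p hp), hXxx p hp]; simp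
  have σ3 : ∀ p ∈ U, pd e₃ σ p = 0 := fun p hp => by
    rw [pd_inv (hX2 p hp) (hx p hp), hXx3 p hp]; simp
  have ρ12 : ∀ p ∈ U, pd e₁ (pd e₂ ρ) p = pd e₂ ρ p ^ 2 := fun p hp => by
    have hp2 := contDiffAt_pd e₂ (hρ p hp)
    rw [pd_comm (hρ p hp), pd_congr_on h.isOpen (fun q hq => (hr q hq).2.2.2.2.1) hp,
      pd_mul (hρ p hp) hp2, (hr p hp).2.2.2.1]
    ring
  have neg1 : ∀ {G : Space → ℝ} {p e : Space}, ContDiffAt ℝ ∞ G p →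
      pd e (fun q => -G q) p = -pd e G p := fun {G p e} hG => by
    have := pd_const_mul (e := e) (-1) hG
    simpa using this
  have σ11 : ∀ p ∈ U, pd e₁ (pd e₁ σ) p = 0 := fun p hp => by
    have hp2 := contDiffAt_pd e₂ (hρ p hp)
    rw [pd_congr_on h.isOpen σ1 hp, neg1 (hp2.mul (hσ p hp)), pd_mul hp2 (hσ p hp), σ1 p hp, ρ12 p hp]
    ring
  obtain ⟨γ, δ, hγ⟩ := exists_eq_affine h.isOpen hU hσ σ11 σ2 σ3
  -- `X σ - x` is affine in `t`
  have hY : ∀ p ∈ U, ContDiffAt ℝ ∞ (fun q => X q * σ q) p := fun p hp => (hX p hp).mul (hσ p hp)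
  have Y1 : ∀ p ∈ U, pd e₁ (fun q => X q * σ q) p = ρ p - pd e₂ ρ p * (X p * σ p) := fun p hp => by
    rw [pd_mul (hX p hp) (hσ p hp), σ1 p hp, (hr p hp).1]
    linear_combination ρ p * hσx p hp
  have Y11 : ∀ p ∈ U, pd e₁ (pd e₁ fun q => X q * σ q) p = 0 := fun p hp => by
    have hp2 := contDiffAt_pd e₂ (hρ p hp)
    rw [pd_congr_on h.isOpen Y1 hp, pd_sub (hρ p hp) (hp2.mul (hY p hp)), pd_mul hp2 (hY p hp),
      Y1 p hp, ρ12 p hp, (hr p hp).2.2.2.2.1]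
    ring
  have hZd : ∀ p ∈ U, ∀ e, pd e (fun q => X q * σ q - q.2.1) p
      = pd e (fun q => X q * σ q) p - e.2.1 := fun p hp e => by
    rw [pd_sub (hY p hp) (by fun_prop), pd_snd_fst]
  obtain ⟨μ₁, μ₀, hμ⟩ := exists_eq_affine (F := fun q => X q * σ q - q.2.1) h.isOpen hU
    (fun p hp => (hY p hp).sub (by fun_prop))
    (fun p hp => by
      rw [pd_congr_on (G := pd e₁ fun q => X q * σ q) h.isOpen
        (fun q hq => by rw [hZd q hq]; simp [e₁]) hp, Y11 p hp])
    (fun p hp => by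
      rw [hZd p hp, pd_mul (hX p hp) (hσ p hp), σ2 p hp]
      rw [show e₂.2.1 = (1 : ℝ) from rfl]
      linear_combination hσx p hp)
    (fun p hp => by
      rw [hZd p hp, pd_mul (hX p hp) (hσ p hp), σ3 p hp, hX3 p hp]
      simp [e₃])
  -- `T σ` is affine in `t`
  have σg : ∀ p ∈ U, pd e₁ σ p = γ := fun p hp => by
    rw [pd_congr_on (G := fun q => γ * q.1 + δ) h.isOpen hγ hp,
      pd_add (by fun_prop) (by fun_prop), pd_const_mul _ (by fun_prop), pd_fst, pd_const]
    simp [e₁]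
  have T1 : ∀ p ∈ U, pd e₁ T p * σ p ^ 2 = c / c' := fun p hp => by
    have e1 := (h.X_projects hc hc' hp).2
    have e2 := hσx p hp
    rw [eq_div_iff hc']
    linear_combination -σ p ^ 2 * e1 + c * (pd e₂ X p * σ p + 1) * e2
  have hTσ : ∀ p ∈ U, ContDiffAt ℝ ∞ (fun q => T q * σ q) p := fun p hp => (hT p hp).mul (hσ p hp)
  have V1 : ∀ p ∈ U, pd e₁ (fun q => T q * σ q) p = γ * T p + pd e₁ T p * σ p := fun p hp => by
    rw [pd_mul (hT p hp) (hσ p hp), σg p hp]; ring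
  have V11 : ∀ p ∈ U, pd e₁ (pd e₁ fun q => T q * σ q) p = 0 := fun p hp => by
    have ht := contDiffAt_pd e₁ (hT p hp)
    have hs := hσ p hp
    have e0 := pd_congr_on (e := e₁) h.isOpen V1 hp
    have e1 := pd_congr_on (F := fun q => pd e₁ T q * (σ q * σ q)) (G := fun _ => c / c') (e := e₁)
      h.isOpen (fun q hq => by rw [← T1 q hq]; ring) hp
    rw [pd_add (contDiffAt_const.mul (hT p hp)) (ht.mul hs), pd_const_mul _ (hT p hp), pd_mul ht hs,
      σg p hp] at e0
    rw [pd_const, pd_mul ht (hs.mul hs), pd_mul hs hs, σg p hp] at e1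
    rw [e0]
    exact mul_left_cancel₀ (hσ0 p hp) (by linear_combination e1)
  have hTe : ∀ p ∈ U, pd e₂ T p = 0 ∧ pd e₃ T p = 0 := fun p hp => h.T_projects hc hc' hp
  obtain ⟨α, β, hα⟩ := exists_eq_affine (F := fun q => T q * σ q) h.isOpen hU hTσ V11
    (fun p hp => by rw [pd_mul (hT p hp) (hσ p hp), σ2 p hp, (hTe p hp).1]; ring)
    (fun p hp => by rw [pd_mul (hT p hp) (hσ p hp), σ3 p hp, (hTe p hp).2]; ring)
  have hρ' : ∀ p ∈ U, ρ p = (μ₁ * δ - γ * μ₀ - γ * p.2.1) / (γ * p.1 + δ) ∧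
      -pd e₂ ρ p / 2 = γ / (2 * (γ * p.1 + δ)) := fun p hp => by
    have e1 : pd e₁ (fun q => X q * σ q) p = μ₁ := by
      rw [pd_congr_on (G := fun q => (μ₁ * q.1 + μ₀) + q.2.1) h.isOpen
        (fun q hq => by linear_combination hμ q hq) hp, pd_add (by fun_prop) (by fun_prop),
        pd_add (by fun_prop) (by fun_prop), pd_const_mul _ (by fun_prop), pd_fst, pd_const,
        pd_snd_fst]
      simp [e₁]
    rw [Y1 p hp] at e1
    have e2 := σ1 p hp
    have e3 := hγ p hp
    have e4 := hσ0 p hp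
    have e5 := hμ p hp
    rw [σg p hp] at e2
    rw [← e3]
    constructor
    · field_simp
      linear_combination σ p * e1 + X p * σ p * e2 + μ₁ * e3 - γ * e5
    · field_simp
      linear_combination -e2
  refine ⟨α, β, γ, δ, μ₁, μ₀, ?_, fun p hp => ⟨?_, ?_, ?_, ?_, ?_⟩⟩
  · obtain ⟨p, hp⟩ := hne
    have e1 : pd e₁ (fun q => T q * σ q) p = α := by
      rw [pd_congr_on (G := fun q => α * q.1 + β) h.isOpen hα hp,
        pd_add (by fun_prop) (by fun_prop), pd_const_mul _ (by fun_prop), pd_fst, pd_const]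
      simp [e₁]
    rw [V1 p hp] at e1
    rw [← T1 p hp]
    have e2 := hγ p hp
    have e3 := hα p hp
    linear_combination -σ p * e1 - α * e2 + γ * e3
  · rw [← hγ p hp]; exact hσ0 p hp
  · rw [← hγ p hp, ← hα p hp]; field_simp [hσ0 p hp]
  · rw [← hγ p hp, eq_div_iff (hσ0 p hp)]
    linear_combination hμ p hp
  · rw [← (hρ' p hp).1]; exact (hr p hp).2.2.2.2.2.1
  · rw [← (hρ' p hp).1, ← (hρ' p hp).2, (hr p hp).2.2.2.2.2.2]
    ring

/-- The explicit form of all the components, with `F²` as a function of `(t, x, u)` that does not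
depend on `u`. -/
theorem exists_params (h : IsHeatMap c c' U T X W) (hc : c ≠ 0) (hc' : c' ≠ 0)
    (hU : IsPreconnected U) (hne : U.Nonempty) :
    ∃ (P : Params) (F : Space → ℝ), P.det = c / c' ∧ P.κ = 1 ∧ P.k ≠ 0 ∧ ∀ p ∈ U,
      P.γ * p.1 + P.δ ≠ 0 ∧ T p = (P.α * p.1 + P.β) / (P.γ * p.1 + P.δ) ∧
      X p = (p.2.1 + P.μ₁ * p.1 + P.μ₀) / (P.γ * p.1 + P.δ) ∧
      W p = P.F1 c p.1 p.2.1 * (p.2.2 + F p) ∧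
      ContDiffAt ℝ ∞ F p ∧ pd e₃ F p = 0 ∧ pd e₁ F p + c * pd e₂ (pd e₂ F) p = 0 := by
  obtain ⟨α, β, γ, δ, μ₁, μ₀, hdet, hTX⟩ := h.exists_fractional_linear hc hc' hU hne
  obtain ⟨ρ, hρ, hr⟩ := h.drift_equations hc hc'
  let P₁ : Params := ⟨α, β, γ, δ, 1, μ₁, μ₀, 1, fun _ => 0⟩
  have hA : ∀ p ∈ U, ContDiffAt ℝ ∞ (pd e₃ W) p := fun p hp => contDiffAt_pd e₃ (h.smooth_W p hp)
  have hA0 : ∀ p ∈ U, pd e₃ W p ≠ 0 := fun p hp => (h.W_equations hc hc' hp).1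
  have hA3 : ∀ p ∈ U, pd e₃ (pd e₃ W) p = 0 := fun p hp => (h.W_equations hc hc' hp).2.1
  let G : Space → ℝ := fun q => P₁.F1 c q.1 q.2.1
  have hb : ∀ p ∈ U, ContDiffAt ℝ ∞ (fun y : Base => P₁.F1 c y.1 y.2) (p.1, p.2.1) := fun p hp =>
    P₁.contDiffAt_F1 hc (hTX p hp).1
  have hG : ∀ p ∈ U, ContDiffAt ℝ ∞ G p := fun p hp => contDiffAt_proj (hb p hp)
  have hG0 : ∀ p ∈ U, G p ≠ 0 := fun p hp =>
    P₁.F1_ne_zero (z := (p.1, p.2.1)) one_ne_zero (hTX p hp).1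
  have hGe : ∀ p ∈ U, pd e₁ G p = (P₁.drift (p.1, p.2.1) ^ 2 / (4 * c)
        + γ / (2 * (γ * p.1 + δ))) * G p ∧
      pd e₂ G p = P₁.drift (p.1, p.2.1) / (2 * c) * G p ∧ pd e₃ G p = 0 := fun p hp => by
    have h1 := P₁.pd_et_F1 (z := (p.1, p.2.1)) hc (hTX p hp).1
    have h2 := P₁.pd_ex_F1 (z := (p.1, p.2.1)) hc (hTX p hp).1
    have h3 := fun e => pd_proj (e := e) (hb p hp)
    refine ⟨?_, ?_, ?_⟩
    · rw [h3 e₁, h1]; simp [e₁, G, P₁]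
    · rw [h3 e₂, h2]; simp [e₂, G, P₁]
    · rw [h3 e₃]; simp [e₃]
  -- the logarithmic derivatives of `W_u` and of the explicit factor coincide
  obtain ⟨k, hk⟩ := exists_eq_const (F := fun q => pd e₃ W q / G q) h.isOpen hU
    (fun p hp => (hA p hp).div (hG p hp) (hG0 p hp))
    (fun p hp => by
      rw [pd_div (hA p hp) (hG p hp) (hG0 p hp), (hTX p hp).2.2.2.2, (hGe p hp).1]
      simp only [Params.drift, P₁]; ring)
    (fun p hp => by
      rw [pd_div (hA p hp) (hG p hp) (hG0 p hp), (hTX p hp).2.2.2.1, (hGe p hp).2.1]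
      simp only [Params.drift, P₁]; ring)
    (fun p hp => by
      rw [pd_div (hA p hp) (hG p hp) (hG0 p hp), hA3 p hp, (hGe p hp).2.2]; ring)
  have hAk : ∀ p ∈ U, pd e₃ W p = k * G p := fun p hp => by
    rw [← hk p hp]; exact (div_mul_cancel₀ _ (hG0 p hp)).symm
  let P : Params := ⟨α, β, γ, δ, 1, μ₁, μ₀, k, fun _ => 0⟩
  have hF1 : ∀ p ∈ U, P.F1 c p.1 p.2.1 = pd e₃ W p := fun p hp => by
    rw [hAk p hp]
    simp only [Params.F1, G, P, P₁]
    split_ifs <;> ring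
  let F : Space → ℝ := fun q => W q / pd e₃ W q - q.2.2
  have hF : ∀ p ∈ U, ContDiffAt ℝ ∞ F p := fun p hp =>
    ((h.smooth_W p hp).div (hA p hp) (hA0 p hp)).sub (by fun_prop)
  have hu : ∀ p : Space, ContDiffAt ℝ ∞ (fun q : Space => q.2.2) p := fun p => by fun_prop
  have hWF : ∀ q ∈ U, W q = pd e₃ W q * (F q + q.2.2) := fun q hq => by
    have := hA0 q hq
    simp only [F]; field_simp; ring
  have hF3 : ∀ p ∈ U, pd e₃ F p = 0 := fun p hp => by
    have hd := (h.smooth_W p hp).div (hA p hp) (hA0 p hp)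
    rw [pd_sub (F := fun q => W q / pd e₃ W q) hd (hu p),
      pd_div (h.smooth_W p hp) (hA p hp) (hA0 p hp), hA3 p hp, pd_snd_snd]
    have := hA0 p hp
    rw [show e₃.2.2 = (1 : ℝ) from rfl]
    field_simp
    ring
  refine ⟨P, F, hdet, rfl, ?_, fun p hp => ⟨(hTX p hp).1, (hTX p hp).2.1, (hTX p hp).2.2.1, ?_,
    hF p hp, hF3 p hp, ?_⟩⟩
  · obtain ⟨p, hp⟩ := hne
    intro hk0
    change k = 0 at hk0
    have := hAk p hp
    rw [hk0, zero_mul] at this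
    exact hA0 p hp this
  · rw [hF1 p hp, hWF p hp]; ring
  · have hFu : ∀ q ∈ U, ContDiffAt ℝ ∞ (fun q => F q + q.2.2) q := fun q hq => (hF q hq).add (hu q)
    have d1 : ∀ q ∈ U, ∀ e, pd e (fun q => F q + q.2.2) q = pd e F q + e.2.2 := fun q hq e => by
      rw [pd_add (hF q hq) (hu q), pd_snd_snd]
    have w1 : ∀ q ∈ U, ∀ e, pd e W q
        = pd e₃ W q * (pd e F q + e.2.2) + pd e (pd e₃ W) q * (F q + q.2.2) := fun q hq e => by
      rw [pd_congr_on h.isOpen hWF hq, pd_mul (hA q hq) (hFu q hq), d1 q hq]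
    have w2 : pd e₂ (pd e₂ W) p = pd e₃ W p * pd e₂ (pd e₂ F) p
        + 2 * (pd e₂ (pd e₃ W) p * pd e₂ F p) + pd e₂ (pd e₂ (pd e₃ W)) p * (F p + p.2.2) := by
      have hA2 := contDiffAt_pd e₂ (hA p hp)
      have hF2 := contDiffAt_pd e₂ (hF p hp)
      rw [pd_congr_on (G := fun q => pd e₃ W q * pd e₂ F q + pd e₂ (pd e₃ W) q * (F q + q.2.2))
        h.isOpen (fun q hq => by rw [w1 q hq]; simp [e₂]) hp,
        pd_add ((hA p hp).mul hF2) (hA2.mul (hFu p hp)), pd_mul (hA p hp) hF2,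
        pd_mul hA2 (hFu p hp), d1 p hp]
      simp [e₂]
      ring
    have e4 := (h.W_equations hc hc' hp).2.2.2
    have a2 := (hr p hp).2.2.2.2.2.1
    have a1 := (hr p hp).2.2.2.2.2.2
    have a22 : pd e₂ (pd e₂ (pd e₃ W)) p
        = (1 / (2 * c)) * (ρ p * pd e₂ (pd e₃ W) p + pd e₂ ρ p * pd e₃ W p) := by
      rw [pd_congr_on (G := fun q => (1 / (2 * c)) * (ρ q * pd e₃ W q)) h.isOpen
        (fun q hq => by rw [(hr q hq).2.2.2.2.2.1]; ring) hp,
        pd_const_mul _ ((hρ p hp).mul (hA p hp)), pd_mul (hρ p hp) (hA p hp)]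
    rw [w2, w1 p hp e₁, w1 p hp e₂, a22, a1, a2, (hr p hp).1] at e4
    rw [show e₁.2.2 = (0 : ℝ) from rfl, show e₂.2.2 = (0 : ℝ) from rfl] at e4
    field_simp at e4
    have hx := h.X_x_ne_zero hc hc' hp
    have := hA0 p hp
    refine mul_left_cancel₀ (mul_ne_zero (mul_ne_zero hx this) hc) ?_
    linear_combination e4 / 16

end IsHeatMap

/-! ### Inverse functions -/

theorem continuousLinearMap_bijective {E : Type*} [NormedAddCommGroup E] [NormedSpace ℝ E]
    [FiniteDimensional ℝ E] (L : E →L[ℝ] E) (h : ∀ x, L x = 0 → x = 0) : Function.Bijective L := by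
  have hi : Function.Injective (L : E →ₗ[ℝ] E) := (injective_iff_map_eq_zero _).2 h
  exact ⟨hi, LinearMap.injective_iff_surjective.1 hi⟩

/-- The inverse function theorem in the form of a smooth bijection between open sets. -/
theorem exists_local_inverse {E : Type*} [NormedAddCommGroup E] [NormedSpace ℝ E]
    [FiniteDimensional ℝ E] {g : E → E} {U₀ : Set E} (hU₀ : IsOpen U₀)
    (hg : ContDiffOn ℝ ∞ g U₀) {z : E} (hz : z ∈ U₀) (hb : Function.Bijective (fderiv ℝ g z)) :
    ∃ (U U' : Set E) (h : E → E), IsOpen U ∧ IsOpen U' ∧ U ⊆ U₀ ∧ z ∈ U ∧ ContDiffOn ℝ ∞ h U' ∧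
      (∀ y ∈ U, g y ∈ U' ∧ h (g y) = y) ∧ ∀ y ∈ U', h y ∈ U ∧ g (h y) = y := by
  have : CompleteSpace E := FiniteDimensional.complete ℝ E
  have hga : ∀ y ∈ U₀, ContDiffAt ℝ ∞ g y := fun y hy => hg.contDiffAt (hU₀.mem_nhds hy)
  let A : E ≃L[ℝ] E := (LinearEquiv.ofBijective (fderiv ℝ g z : E →ₗ[ℝ] E) hb).toContinuousLinearEquiv
  have hA : (A : E →L[ℝ] E) = fderiv ℝ g z := by ext; rfl
  have hs : HasStrictFDerivAt g (A : E →L[ℝ] E) z := by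
    rw [hA]; exact (hga z hz).hasStrictFDerivAt (by simp)
  let e := hs.toOpenPartialHomeomorph g
  have he : ∀ y, e y = g y := fun y => rfl
  have hcont : ContinuousOn (fderiv ℝ g) U₀ := hg.continuousOn_fderiv_of_isOpen hU₀ (by simp)
  have hopen : IsOpen (U₀ ∩ fderiv ℝ g ⁻¹' range ((↑) : (E ≃L[ℝ] E) → E →L[ℝ] E)) :=
    hcont.isOpen_inter_preimage hU₀ ContinuousLinearEquiv.isOpen
  set V := U₀ ∩ fderiv ℝ g ⁻¹' range ((↑) : (E ≃L[ℝ] E) → E →L[ℝ] E)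
  have hzV : z ∈ V := ⟨hz, A, hA⟩
  refine ⟨e.source ∩ V, e.target ∩ e.symm ⁻¹' V, e.symm, e.open_source.inter hopen,
    e.isOpen_inter_preimage_symm hopen, fun y hy => hy.2.1,
    ⟨hs.mem_toOpenPartialHomeomorph_source, hzV⟩, ?_, ?_, ?_⟩
  · rintro y ⟨hy, hyV, B, hB⟩
    refine ContDiffAt.contDiffWithinAt ?_
    refine e.contDiffAt_symm (f₀' := B) hy ?_ (hga _ hyV)
    rw [hB]
    exact ((hga _ hyV).differentiableAt (by simp)).hasFDerivAt
  · rintro y ⟨hy, hyV⟩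
    have h1 := e.left_inv hy
    exact ⟨⟨e.map_source hy, by rw [mem_preimage, ← he, h1]; exact hyV⟩, h1⟩
  · rintro y ⟨hy, hyV⟩
    exact ⟨⟨e.map_target hy, hyV⟩, e.right_inv hy⟩

/-- The differentials of the components of a diffeomorphism are linearly independent. -/
theorem IsDiffeoOn.indep {D : Set Space} {φ : Space → Space} (h : IsDiffeoOn D φ) {p : Space}
    (hp : p ∈ D) {l m n : ℝ}
    (h1 : l * pd e₁ (fun q => (φ q).1) p + m * pd e₁ (fun q => (φ q).2.1) p
      + n * pd e₁ (fun q => (φ q).2.2) p = 0)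
    (h2 : l * pd e₂ (fun q => (φ q).1) p + m * pd e₂ (fun q => (φ q).2.1) p
      + n * pd e₂ (fun q => (φ q).2.2) p = 0)
    (h3 : l * pd e₃ (fun q => (φ q).1) p + m * pd e₃ (fun q => (φ q).2.1) p
      + n * pd e₃ (fun q => (φ q).2.2) p = 0) : l = 0 ∧ m = 0 ∧ n = 0 := by
  have hd : HasFDerivAt φ (fderiv ℝ φ p) p :=
    ((h.2.1.contDiffAt (h.1.mem_nhds hp)).differentiableAt (by simp)).hasFDerivAt
  have d1 : ∀ w, fderiv ℝ (fun q => (φ q).1) p w = (fderiv ℝ φ p w).1 := fun w => by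
    rw [hd.fst.fderiv]; rfl
  have d2 : ∀ w, fderiv ℝ (fun q => (φ q).2.1) p w = (fderiv ℝ φ p w).2.1 := fun w => by
    rw [hd.snd.fst.fderiv]; rfl
  have d3 : ∀ w, fderiv ℝ (fun q => (φ q).2.2) p w = (fderiv ℝ φ p w).2.2 := fun w => by
    rw [hd.snd.snd.fderiv]; rfl
  have key : ∀ w : Space, l * w.1 + m * w.2.1 + n * w.2.2 = 0 := by
    intro w
    obtain ⟨w', rfl⟩ := (h.2.2.2 p hp).2 w
    rw [← d1, ← d2, ← d3, fderiv_space, fderiv_space, fderiv_space]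
    linear_combination w'.1 * h1 + w'.2.1 * h2 + w'.2.2 * h3
  have k1 := key (1, 0, 0)
  have k2 := key (0, 1, 0)
  have k3 := key (0, 0, 1)
  simp at k1 k2 k3
  exact ⟨k1, k2, k3⟩

/-! ### Passage to the heat equation -/

/-- The Hopf-Cole substitution `(t, x, u) ↦ (t, x, c ln u)`. -/
def hopfCole (c : ℝ) (p : Space) : Space := (p.1, p.2.1, c * Real.log p.2.2)

/-- The set of points `(t, x, u)`, `u > 0`, whose images under the Hopf-Cole substitution are in
`U`. -/
def hatSet (c : ℝ) (U : Set Space) : Set Space := {p | 0 < p.2.2 ∧ hopfCole c p ∈ U}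

theorem contDiffAt_hopfCole {c : ℝ} {p : Space} (hp : 0 < p.2.2) :
    ContDiffAt ℝ ∞ (hopfCole c) p := by
  have h : ContDiffAt ℝ ∞ (fun q : Space => Real.log q.2.2) p :=
    ContDiffAt.log (by fun_prop) hp.ne'
  exact contDiffAt_fst.prodMk (ContDiffAt.prodMk (by fun_prop) (contDiffAt_const.mul h))

theorem isOpen_hatSet (c : ℝ) {U : Set Space} (hU : IsOpen U) : IsOpen (hatSet c U) := by
  have h0 : IsOpen {p : Space | 0 < p.2.2} := isOpen_lt continuous_const (by fun_prop)
  have hc : ContinuousOn (hopfCole c) {p : Space | 0 < p.2.2} := fun p hp =>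
    (contDiffAt_hopfCole hp).continuousAt.continuousWithinAt
  exact hc.isOpen_inter_preimage h0 hU

theorem hopfCole_exp {c : ℝ} (hc : c ≠ 0) (t x v : ℝ) :
    hopfCole c (t, x, Real.exp (v / c)) = (t, x, v) := by
  simp only [hopfCole, Real.log_exp]
  rw [mul_div_cancel₀ _ hc]

theorem exp_mem_hatSet {c : ℝ} (hc : c ≠ 0) {U : Set Space} {t x v : ℝ} :
    (t, x, Real.exp (v / c)) ∈ hatSet c U ↔ (t, x, v) ∈ U := by
  simp only [hatSet, mem_ofPred_eq, hopfCole_exp hc, Real.exp_pos, true_and]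

theorem hatSet_eq_image {c : ℝ} (hc : c ≠ 0) (U : Set Space) :
    hatSet c U = (fun p : Space => ((p.1, p.2.1, Real.exp (p.2.2 / c)) : Space)) '' U := by
  ext p
  constructor
  · rintro ⟨h0, h1⟩
    refine ⟨_, h1, ?_⟩
    simp only [hopfCole]
    rw [mul_div_cancel_left₀ _ hc, Real.exp_log h0]
  · rintro ⟨⟨t, x, v⟩, h1, rfl⟩
    exact (exp_mem_hatSet hc).2 h1

theorem pd_hopfCole {c : ℝ} {F : Space → ℝ} {p e : Space} (hp : 0 < p.2.2)
    (hF : ContDiffAt ℝ ∞ F (hopfCole c p)) :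
    pd e (fun q => F (hopfCole c q)) p = pd e₁ F (hopfCole c p) * e.1
      + pd e₂ F (hopfCole c p) * e.2.1 + pd e₃ F (hopfCole c p) * (c / p.2.2 * e.2.2) := by
  have h1 := hasFDerivAt_fst (𝕜 := ℝ) (p := p)
  have h2 := hasFDerivAt_snd (𝕜 := ℝ) (p := p)
  have h : HasFDerivAt (hopfCole c) _ p := h1.prodMk (h2.fst.prodMk ((h2.snd.log hp.ne').const_mul c))
  have h3 := ((differentiableAt_of_smooth hF).hasFDerivAt.comp p h).fderiv
  rw [show pd e (fun q => F (hopfCole c q)) p = fderiv ℝ (F ∘ hopfCole c) p e from rfl, h3,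
    ContinuousLinearMap.comp_apply, fderiv_space]
  simp
  left
  ring

theorem bijective_fderiv_of_jacobian {a b : Base → ℝ} {z : Base} (ha : ContDiffAt ℝ ∞ a z)
    (hb : ContDiffAt ℝ ∞ b z) (hJ : pd et a z * pd ex b z - pd ex a z * pd et b z ≠ 0) :
    Function.Bijective (fderiv ℝ (fun y => (a y, b y)) z) := by
  refine continuousLinearMap_bijective _ fun w hw => ?_
  rw [((differentiableAt_of_smooth ha).hasFDerivAt.prodMk
    (differentiableAt_of_smooth hb).hasFDerivAt).fderiv] at hw
  simp only [ContinuousLinearMap.prod_apply, fderiv_base, Prod.mk_eq_zero] at hw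
  obtain ⟨h1, h2⟩ := hw
  refine Prod.ext (?_ : w.1 = 0) (?_ : w.2 = 0)
  · exact mul_left_cancel₀ hJ (by linear_combination pd ex b z * h1 - pd ex a z * h2)
  · exact mul_left_cancel₀ hJ (by linear_combination pd et a z * h2 - pd et b z * h1)

/-- An admissible transformation between potential Burgers equations is, up to Hopf-Cole
substitutions of both equations, one between heat equations. -/
theorem isHeatMap_of_isAdmissible {f f' : Base → ℝ} {c c' : ℝ} (hc : c ≠ 0) (hc' : c' ≠ 0)
    (hf : ∀ z, f z = c) (hf' : ∀ z, f' z = c') {D : Set Space} {φ : Space → Space}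
    (h : IsAdmissible f f' D φ) {U : Set Space} (hU : IsOpen U) (hUD : U ⊆ D) :
    IsHeatMap c c' (hatSet c U) (fun p => (φ (hopfCole c p)).1) (fun p => (φ (hopfCole c p)).2.1)
      (fun p => Real.exp ((φ (hopfCole c p)).2.2 / c')) := by
  obtain ⟨-, hφ, hmap⟩ := h
  have hs : ∀ q ∈ U, ContDiffAt ℝ ∞ φ q := fun q hq =>
    hφ.2.1.contDiffAt (hφ.1.mem_nhds (hUD hq))
  have hsc : ∀ p ∈ hatSet c U, ContDiffAt ℝ ∞ (fun p => φ (hopfCole c p)) p := fun p hp =>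
    ContDiffAt.comp p (hs _ hp.2) (contDiffAt_hopfCole hp.1)
  have hT : ∀ p ∈ hatSet c U, ContDiffAt ℝ ∞ (fun p => (φ (hopfCole c p)).1) p :=
    fun p hp => (hsc p hp).fst
  have hX : ∀ p ∈ hatSet c U, ContDiffAt ℝ ∞ (fun p => (φ (hopfCole c p)).2.1) p :=
    fun p hp => (hsc p hp).snd.fst
  have hV : ∀ p ∈ hatSet c U, ContDiffAt ℝ ∞ (fun p => (φ (hopfCole c p)).2.2) p :=
    fun p hp => (hsc p hp).snd.snd
  have hO := isOpen_hatSet c hU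
  refine ⟨hO, hT, hX, fun p hp => ((hV p hp).div_const c').exp, ?_, ?_⟩
  · intro p hp l m n h1 h2 h3
    have hexp : ∀ e, pd e (fun p => Real.exp ((φ (hopfCole c p)).2.2 / c')) p
        = Real.exp ((φ (hopfCole c p)).2.2 / c') * (1 / c')
          * pd e (fun p => (φ (hopfCole c p)).2.2) p := fun e =>
      pd_comp_real (f := fun r => Real.exp (r / c')) ((hasDerivAt_id _).div_const c').exp (hV p hp)
    have g1 := fun e => pd_hopfCole (F := fun q => (φ q).1) (e := e) hp.1 (hs _ hp.2).fst
    have g2 := fun e => pd_hopfCole (F := fun q => (φ q).2.1) (e := e) hp.1 (hs _ hp.2).snd.fst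
    have g3 := fun e => pd_hopfCole (F := fun q => (φ q).2.2) (e := e) hp.1 (hs _ hp.2).snd.snd
    rw [hexp, g1, g2, g3] at h1 h2 h3
    simp only [show e₁.1 = (1 : ℝ) from rfl, show e₁.2.1 = (0 : ℝ) from rfl,
      show e₁.2.2 = (0 : ℝ) from rfl, show e₂.1 = (0 : ℝ) from rfl,
      show e₂.2.1 = (1 : ℝ) from rfl, show e₂.2.2 = (0 : ℝ) from rfl,
      show e₃.1 = (0 : ℝ) from rfl, show e₃.2.1 = (0 : ℝ) from rfl,
      show e₃.2.2 = (1 : ℝ) from rfl] at h1 h2 h3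
    have hcp : c / p.2.2 ≠ 0 := div_ne_zero hc hp.1.ne'
    have hn : Real.exp ((φ (hopfCole c p)).2.2 / c') * (1 / c') ≠ 0 :=
      mul_ne_zero (Real.exp_pos _).ne' (one_div_ne_zero hc')
    obtain ⟨r1, r2, r3⟩ := hφ.indep (hUD hp.2) (l := l) (m := m)
      (n := n * (Real.exp ((φ (hopfCole c p)).2.2 / c') * (1 / c')))
      (by linear_combination h1) (by linear_combination h2)
      (mul_left_cancel₀ hcp (by linear_combination h3))
    exact ⟨r1, r2, (mul_eq_zero.1 r3).resolve_right hn⟩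
  · intro z u hz hu hheat hJ
    have hγ : ContDiff ℝ ∞ (fun y : Base => ((y.1, y.2, u y) : Space)) := by fun_prop
    set U₀ : Set Base := {y | (y.1, y.2, u y) ∈ hatSet c U} with hU₀d
    have hU₀ : IsOpen U₀ := hO.preimage hγ.continuous
    set v : Base → ℝ := fun y => c * Real.log (u y) with hv
    have hvs : ∀ y ∈ U₀, ContDiffAt ℝ ∞ v y := fun y hy =>
      contDiffAt_const.mul (hu.contDiffAt.log hy.1.ne')
    set a : Base → ℝ := fun y => (φ (y.1, y.2, v y)).1 with ha
    set b : Base → ℝ := fun y => (φ (y.1, y.2, v y)).2.1 with hb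
    have hφs : ∀ y ∈ U₀, ContDiffAt ℝ ∞ (fun y : Base => φ (y.1, y.2, v y)) y := fun y hy =>
      ContDiffAt.comp y (g := φ) (f := fun y : Base => ((y.1, y.2, v y) : Space)) (hs _ hy.2)
        (contDiffAt_fst.prodMk (contDiffAt_snd.prodMk (hvs y hy)))
    have has : ∀ y ∈ U₀, ContDiffAt ℝ ∞ a y := fun y hy => (hφs y hy).fst
    have hbs : ∀ y ∈ U₀, ContDiffAt ℝ ∞ b y := fun y hy => (hφs y hy).snd.fst
    obtain ⟨U₁, U₁', g, hU₁, hU₁', hsub, hzU, hgs, hl, hr⟩ :=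
      exists_local_inverse (g := fun y => (a y, b y)) hU₀
        (fun y hy => ((has y hy).prodMk (hbs y hy)).contDiffWithinAt) hz
        (bijective_fderiv_of_jacobian (has z hz) (hbs z hz) hJ)
    set v' : Base → ℝ := fun y => (φ ((g y).1, (g y).2, v (g y))).2.2 with hv'
    have hvs' : ∀ y ∈ U₁', ContDiffAt ℝ ∞ v' y := fun y hy => by
      have h1 := (hφs _ (hsub (hr y hy).1)).snd.snd
      exact ContDiffAt.comp y (g := fun y : Base => (φ (y.1, y.2, v y)).2.2) h1
        (hgs.contDiffAt (hU₁'.mem_nhds hy))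
    have hgraph : φ '' graphOver U₁ v = graphOver U₁' v' := by
      ext q
      constructor
      · rintro ⟨⟨t, x, w⟩, ⟨hm, hw⟩, rfl⟩
        obtain ⟨k1, k2⟩ := hl (t, x) hm
        simp only at hw hm
        subst hw
        refine ⟨k1, ?_⟩
        have : g ((φ (t, x, v (t, x))).1, (φ (t, x, v (t, x))).2.1) = (t, x) := k2
        simp only [hv', this]
      · rintro ⟨hm, hw⟩
        obtain ⟨k1, k2⟩ := hr _ hm
        refine ⟨((g (q.1, q.2.1)).1, (g (q.1, q.2.1)).2, v (g (q.1, q.2.1))), ⟨k1, rfl⟩, ?_⟩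
        exact Prod.ext (Prod.mk.inj k2).1 (Prod.ext (Prod.mk.inj k2).2 hw.symm)
    have hev1 : ∀ y ∈ U₁, ∀ᶠ y in 𝓝 y, ContDiffAt ℝ ∞ v y := fun y hy =>
      eventually_of_mem (hU₁.mem_nhds hy) fun y hy => hvs y (hsub hy)
    have hsol : Solves f U₁ v := by
      rw [solves_iff hf hU₁]
      refine ⟨fun y hy => (hvs y (hsub hy)).contDiffWithinAt, fun y hy => ?_⟩
      have h1 := heatOp_exp hc (hev1 y hy)
      have h2 : (fun y => Real.exp (v y / c)) =ᶠ[𝓝 y] u :=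
        eventually_of_mem (hU₁.mem_nhds hy) fun y hy => by
          simp only [hv]
          rw [mul_div_cancel_left₀ _ hc, Real.exp_log (hsub hy).1]
      rw [heatOp_congr h2, hheat] at h1
      exact (mul_eq_zero.1 h1.symm).resolve_left (div_ne_zero (Real.exp_pos _).ne' hc)
    have hsol' := ((hmap U₁ U₁' v v' hU₁ hU₁' (fun y hy => (hvs y (hsub hy)).contDiffWithinAt)
      (fun y hy => (hvs' y hy).contDiffWithinAt)
      (by
        rintro ⟨t, x, w⟩ ⟨hm, hw⟩
        simp only at hw hm
        subst hw
        exact hUD (hsub hm).2) hgraph).1 hsol)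
    rw [solves_iff hf' hU₁'] at hsol'
    have hzz : (a z, b z) ∈ U₁' := (hl z hzU).1
    refine ⟨fun y => Real.exp (v' y / c'), ?_, ?_, ?_⟩
    · exact eventually_of_mem (hU₁'.mem_nhds hzz) fun y hy => ((hvs' y hy).div_const c').exp
    · change heatOp c' _ (a z, b z) = 0
      rw [heatOp_exp hc' (eventually_of_mem (hU₁'.mem_nhds hzz) hvs'), hsol'.2 _ hzz, mul_zero]
    · refine eventually_of_mem (hU₁.mem_nhds hzU) fun y hy => ?_
      have : g ((φ (hopfCole c (y.1, y.2, u y))).1, (φ (hopfCole c (y.1, y.2, u y))).2.1) = y :=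
        (hl y hy).2
      simp only [hv', this]
      rfl

/-- On a regular domain, a function of `(t, x, u)` that locally does not depend on `u` is a function
of `(t, x)`. -/
theorem exists_descend {c : ℝ} (hc : c ≠ 0) {U : Set Space} (hU : IsRegularDomain U)
    {F : Space → ℝ} (hF : ∀ p ∈ hatSet c U, ContDiffAt ℝ ∞ F p)
    (h3 : ∀ p ∈ hatSet c U, pd e₃ F p = 0) :
    ∃ F₂ : Base → ℝ, ∀ t x v, (t, x, v) ∈ U → F₂ (t, x) = F (t, x, Real.exp (v / c)) := by
  classical
  refine ⟨fun z => if h : ∃ v, (z.1, z.2, v) ∈ U then F (z.1, z.2, Real.exp (h.choose / c)) else 0,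
    fun t x v hv => ?_⟩
  have hex : ∃ v, (t, x, v) ∈ U := ⟨v, hv⟩
  simp only [dif_pos hex]
  have hopen : IsOpen {v : ℝ | (t, x, v) ∈ U} :=
    hU.1.preimage (f := fun v : ℝ => ((t, x, v) : Space)) (by fun_prop)
  have hd : ∀ s ∈ {v : ℝ | (t, x, v) ∈ U},
      HasDerivAt (fun s => F (t, x, Real.exp (s / c))) 0 s := fun s hs => by
    have hm := (exp_mem_hatSet hc).2 hs
    have h1 : HasDerivAt (fun s : ℝ => ((t, x, Real.exp (s / c)) : Space))
        (0, 0, Real.exp (s / c) * (1 / c)) s :=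
      (hasDerivAt_const s t).prodMk ((hasDerivAt_const s x).prodMk ((hasDerivAt_id s).div_const c).exp)
    have h2 := (differentiableAt_of_smooth (hF _ hm)).hasFDerivAt.comp_hasDerivAt s h1
    rw [fderiv_space, h3 _ hm] at h2
    simpa [Function.comp_def] using h2
  exact hopen.is_const_of_deriv_eq_zero (hU.2.2 t x).isPreconnected
    (fun s hs => (hd s hs).differentiableAt.differentiableWithinAt)
    (fun s hs => (hd s hs).deriv) hex.choose_spec hv

/-- A solution of the heat equation that does not depend on `u` remains one after the descent to
`(t, x)`: near each point it is the restriction to a hyperplane `u = const`. -/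
theorem solvesHeat_descend {c : ℝ} (hc : c ≠ 0) {U : Set Space} (hU : IsOpen U)
    {F : Space → ℝ} (hF : ∀ p ∈ hatSet c U, ContDiffAt ℝ ∞ F p)
    (heat : ∀ p ∈ hatSet c U, pd e₁ F p + c * pd e₂ (pd e₂ F) p = 0) {F₂ : Base → ℝ}
    (h2 : ∀ t x v, (t, x, v) ∈ U → F₂ (t, x) = F (t, x, Real.exp (v / c))) :
    Params.SolvesHeat c {z | ∃ v, (z.1, z.2, v) ∈ U} F₂ := by
  have hopen : ∀ v, IsOpen {z : Base | (z.1, z.2, v) ∈ U} := fun v =>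
    hU.preimage (f := fun z : Base => ((z.1, z.2, v) : Space)) (by fun_prop)
  have hW : IsOpen {z : Base | ∃ v, (z.1, z.2, v) ∈ U} := by
    simpa only [ofPred_exists] using isOpen_iUnion hopen
  have hloc : ∀ z : Base, ∀ v, (z.1, z.2, v) ∈ U →
      F₂ =ᶠ[𝓝 z] fun y => F (y.1, y.2, Real.exp (v / c)) := fun z v hv =>
    eventually_of_mem ((hopen v).mem_nhds hv) fun y hy => h2 y.1 y.2 v hy
  have hsm : ∀ z : Base, ∀ v, (z.1, z.2, v) ∈ U →
      ContDiffAt ℝ ∞ (fun y : Base => F (y.1, y.2, Real.exp (v / c))) z := fun z v hv =>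
    ContDiffAt.comp z (f := fun y : Base => ((y.1, y.2, Real.exp (v / c)) : Space))
      (hF _ ((exp_mem_hatSet hc).2 hv)) (by fun_prop)
  rw [solvesHeat_iff hW]
  refine ⟨fun z ⟨v, hv⟩ => ((hsm z v hv).congr_of_eventuallyEq (hloc z v hv)).contDiffWithinAt,
    fun z ⟨v, hv⟩ => ?_⟩
  have hm := (exp_mem_hatSet hc).2 hv
  have hcst : ∀ᶠ y in 𝓝 z, ContDiffAt ℝ ∞ (fun _ : Base => Real.exp (v / c)) y :=
    Eventually.of_forall fun y => contDiffAt_const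
  have hz : ∀ e e' : Base, pd e (pd e' fun _ : Base => Real.exp (v / c)) z = 0 := fun e e' => by
    rw [show (pd e' fun _ : Base => Real.exp (v / c)) = fun _ => 0 from
      funext fun y => pd_const _, pd_const]
  rw [heatOp_congr (hloc z v hv), heatOp,
    pd_graph_et (u := fun _ => Real.exp (v / c)) (hF _ hm) contDiffAt_const,
    pd_pd_graph (u := fun _ => Real.exp (v / c))
      (eventually_of_mem ((isOpen_hatSet c hU).mem_nhds hm) hF) hcst, hz, pd_const, pd_const]
  have := heat _ hm
  simp only [ex]
  linear_combination this

/-- The explicit form of the transformation induced by a transformation that carries the constant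
`c` to the constant `c'`, on a regular domain. -/
theorem exists_represents {Ω : Set ExtSpace} {Φ : ExtSpace → ExtSpace} {f f' : Base → ℝ} {c c' : ℝ}
    (hc : c ≠ 0) (hc' : c' ≠ 0) (hf : ∀ z, f z = c) (hf' : ∀ z, f' z = c')
    (h : Carries Ω Φ f f') {U : Set Space} (hU : IsRegularDomain U)
    (hUΩ : ∀ t x v : ℝ, (t, x, v) ∈ U → (t, x, v, c) ∈ Ω) :
    ∃ P : Params, P.Represents c c' U Φ := by
  have hsub : U ⊆ slice Ω f := fun p hp => by
    simp only [slice, mem_ofPred_eq, hf]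
    exact hUΩ p.1 p.2.1 p.2.2 hp
  have hH := isHeatMap_of_isAdmissible hc hc' hf hf' h.1 hU.1 hsub
  have himg := hatSet_eq_image hc U
  have hcon : IsConnected (hatSet c U) := by
    rw [himg]
    exact hU.2.1.image _ (by fun_prop)
  obtain ⟨P, F, hdet, hκ, hk, hP⟩ := hH.exists_params hc hc' hcon.isPreconnected hcon.nonempty
  obtain ⟨F₂, hF₂⟩ := exists_descend hc hU (fun p hp => (hP p hp).2.2.2.2.1)
    (fun p hp => (hP p hp).2.2.2.2.2.1)
  have hd0 : P.det ≠ 0 := by rw [hdet]; exact div_ne_zero hc hc'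
  have hc'd : P.κ ^ 2 / P.det * c = c' := by rw [hκ, hdet]; field_simp
  refine ⟨{ P with F2 := F₂ }, hd0, by rw [hκ]; exact one_ne_zero, hk, hc'd.symm,
    solvesHeat_descend hc hU.1 (fun p hp => (hP p hp).2.2.2.2.1)
      (fun p hp => (hP p hp).2.2.2.2.2.2) hF₂, fun t x v hv => ?_⟩
  obtain ⟨h1, h2, h3, h4, -⟩ := hP _ ((exp_mem_hatSet hc).2 hv)
  rw [hopfCole_exp hc] at h2 h3 h4
  simp only [induced, hf] at h1 h2 h3 h4
  rw [← hF₂ t x v hv] at h4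
  have h5 := h.2 t x v (hsub hv)
  rw [hf, hf'] at h5
  have hpos : Real.exp (v / c) + F₂ (t, x) ≠ 0 := fun h0 => by
    rw [h0, mul_zero] at h4; exact (Real.exp_pos _).ne' h4
  refine ⟨h1, hpos, ?_⟩
  have hF1 : Params.F1 { P with F2 := F₂ } c t x = P.F1 c t x := rfl
  have hdd : Params.det { P with F2 := F₂ } = P.det := rfl
  have h6 : P.κ ^ 2 * c / P.det = c' := by rw [← hc'd]; ring
  rw [hF1, hdd]
  simp only
  rw [hc'd, h6, ← h4, abs_of_pos (Real.exp_pos _), Real.log_exp, mul_div_cancel₀ _ hc', hκ, one_mul,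
    ← h2, ← h3, ← h5]

/-! ### Transformations of the explicit form are admissible -/

namespace Params

variable (P : Params) {c c' : ℝ} {z : Base}

/-- The component `(α t + β) / (γ t + δ)` of the transformation. -/
def tNew (y : Base) : ℝ := (P.α * y.1 + P.β) / (P.γ * y.1 + P.δ)

/-- The component `κ (x + μ₁ t + μ₀) / (γ t + δ)` of the transformation. -/
def xNew (y : Base) : ℝ := P.κ * ((y.2 + P.μ₁ * y.1 + P.μ₀) / (P.γ * y.1 + P.δ))

theorem eventually_denom_ne_zero (hz : P.γ * z.1 + P.δ ≠ 0) :
    ∀ᶠ y in 𝓝 z, P.γ * y.1 + P.δ ≠ 0 :=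
  ContinuousAt.eventually_ne (by fun_prop) hz

theorem contDiffAt_tNew (hz : P.γ * z.1 + P.δ ≠ 0) : ContDiffAt ℝ ∞ P.tNew z :=
  ContDiffAt.div (by fun_prop) (by fun_prop) hz

theorem contDiffAt_xNew (hz : P.γ * z.1 + P.δ ≠ 0) : ContDiffAt ℝ ∞ P.xNew z :=
  contDiffAt_const.mul (ContDiffAt.div (by fun_prop) (by fun_prop) hz)

theorem contDiffAt_drift (hz : P.γ * z.1 + P.δ ≠ 0) : ContDiffAt ℝ ∞ P.drift z :=
  ContDiffAt.div (by fun_prop) (by fun_prop) hz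

theorem pd_et_tNew (hz : P.γ * z.1 + P.δ ≠ 0) :
    pd et P.tNew z = P.det / (P.γ * z.1 + P.δ) ^ 2 := by
  obtain ⟨t, x⟩ := z
  refine pd_et_of_hasDerivAt (P.contDiffAt_tNew hz) ?_
  have ht := hasDerivAt_id t
  refine (((ht.const_mul P.α).add_const P.β).fun_div ((ht.const_mul P.γ).add_const P.δ)
    hz).congr_deriv ?_
  simp only [det, id]
  ring

theorem pd_ex_tNew (hz : P.γ * z.1 + P.δ ≠ 0) : pd ex P.tNew z = 0 := by
  obtain ⟨t, x⟩ := z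
  exact pd_ex_of_hasDerivAt (P.contDiffAt_tNew hz)
    (hasDerivAt_const x ((P.α * t + P.β) / (P.γ * t + P.δ)))

theorem pd_ex_xNew (hz : P.γ * z.1 + P.δ ≠ 0) : pd ex P.xNew z = P.κ / (P.γ * z.1 + P.δ) := by
  obtain ⟨t, x⟩ := z
  refine pd_ex_of_hasDerivAt (P.contDiffAt_xNew hz) ?_
  refine (((((hasDerivAt_id x).add_const (P.μ₁ * t)).add_const P.μ₀).div_const
    (P.γ * t + P.δ)).const_mul P.κ).congr_deriv ?_
  ring

theorem pd_et_xNew (hz : P.γ * z.1 + P.δ ≠ 0) :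
    pd et P.xNew z = P.drift z * (P.κ / (P.γ * z.1 + P.δ)) := by
  obtain ⟨t, x⟩ := z
  refine pd_et_of_hasDerivAt (P.contDiffAt_xNew hz) ?_
  have ht := hasDerivAt_id t
  refine (((((ht.const_mul P.μ₁).const_add x).add_const P.μ₀).fun_div
    ((ht.const_mul P.γ).add_const P.δ) hz).const_mul P.κ).congr_deriv ?_
  simp only [drift, id]
  simp only at hz
  field_simp
  ring

theorem pd_ex_drift (hz : P.γ * z.1 + P.δ ≠ 0) :
    pd ex P.drift z = -(P.γ / (P.γ * z.1 + P.δ)) := by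
  obtain ⟨t, x⟩ := z
  refine pd_ex_of_hasDerivAt (P.contDiffAt_drift hz) ?_
  refine ((((hasDerivAt_id x).const_mul P.γ).const_sub (P.μ₁ * P.δ - P.γ * P.μ₀)).div_const
    (P.γ * t + P.δ)).congr_deriv ?_
  ring

theorem pd_ex_pd_ex_tNew (hz : P.γ * z.1 + P.δ ≠ 0) : pd ex (pd ex P.tNew) z = 0 := by
  rw [pd_congr (G := fun _ => 0) ((P.eventually_denom_ne_zero hz).mono fun y hy => P.pd_ex_tNew hy),
    pd_const]

theorem pd_ex_pd_ex_xNew (hz : P.γ * z.1 + P.δ ≠ 0) : pd ex (pd ex P.xNew) z = 0 := by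
  rw [pd_congr (G := fun y => P.κ / (P.γ * y.1 + P.δ))
    ((P.eventually_denom_ne_zero hz).mono fun y hy => P.pd_ex_xNew hy)]
  obtain ⟨t, x⟩ := z
  exact pd_ex_of_hasDerivAt (ContDiffAt.div (by fun_prop) (by fun_prop) hz)
    (hasDerivAt_const x (P.κ / (P.γ * t + P.δ)))

/-- The explicit transformation intertwines the heat operators. The function `H` stands for
`exp (v / c) + F²`, and the sign `ε` for that of the expression under the logarithm. -/
theorem heatOp_explicit (hc : c ≠ 0) (hdet : P.det ≠ 0) (hc' : c' = P.κ ^ 2 / P.det * c)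
    (hz : P.γ * z.1 + P.δ ≠ 0) {H w : Base → ℝ} {ε : ℝ} (hH : ∀ᶠ y in 𝓝 z, ContDiffAt ℝ ∞ H y)
    (hw : ∀ᶠ y in 𝓝 (P.tNew z, P.xNew z), ContDiffAt ℝ ∞ w y)
    (h : ∀ᶠ y in 𝓝 z, w (P.tNew y, P.xNew y) = ε * (P.F1 c y.1 y.2 * H y)) :
    P.det / (P.γ * z.1 + P.δ) ^ 2 * heatOp c' w (P.tNew z, P.xNew z)
      = ε * P.F1 c z.1 z.2 * heatOp c H z := by
  have hev := P.eventually_denom_ne_zero hz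
  have hH0 := hH.self_of_nhds
  set A : Base → ℝ := fun y => P.F1 c y.1 y.2 with hA
  have hAs : ∀ y : Base, P.γ * y.1 + P.δ ≠ 0 → ContDiffAt ℝ ∞ A y := fun y hy =>
    P.contDiffAt_F1 hc hy
  have hAx : ∀ y : Base, P.γ * y.1 + P.δ ≠ 0 → pd ex A y = P.drift y / (2 * c) * A y := fun y hy =>
    P.pd_ex_F1 hc hy
  have hAt : pd et A z = (P.drift z ^ 2 / (4 * c) + P.γ / (2 * (P.γ * z.1 + P.δ))) * A z :=
    P.pd_et_F1 hc hz
  have hAxx : pd ex (pd ex A) z = (1 / (2 * c)) * (P.drift z * (P.drift z / (2 * c) * A z)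
      + -(P.γ / (P.γ * z.1 + P.δ)) * A z) := by
    rw [pd_congr (G := fun y => (1 / (2 * c)) * (P.drift y * A y))
      (hev.mono fun y hy => by rw [hAx y hy]; ring),
      pd_const_mul _ ((P.contDiffAt_drift hz).mul (hAs z hz)),
      pd_mul (P.contDiffAt_drift hz) (hAs z hz), hAx z hz, P.pd_ex_drift hz]
  set W : Base → ℝ := fun y => ε * (A y * H y) with hW
  have hW1 : ∀ e, ∀ᶠ y in 𝓝 z, pd e W y = ε * (A y * pd e H y + pd e A y * H y) := fun e => by
    filter_upwards [hev, hH] with y h1 h2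
    rw [pd_const_mul _ ((hAs y h1).mul h2), pd_mul (hAs y h1) h2]
  have hW2 : pd ex (pd ex W) z = ε * ((A z * pd ex (pd ex H) z + pd ex A z * pd ex H z)
      + (pd ex A z * pd ex H z + pd ex (pd ex A) z * H z)) := by
    have h1 := contDiffAt_pd ex hH0
    have h2 := contDiffAt_pd ex (hAs z hz)
    rw [pd_congr (hW1 ex), pd_const_mul _ (((hAs z hz).mul h1).add (h2.mul hH0)),
      pd_add ((hAs z hz).mul h1) (h2.mul hH0), pd_mul (hAs z hz) h1, pd_mul h2 hH0]
  have hTs : ∀ᶠ y in 𝓝 z, ContDiffAt ℝ ∞ P.tNew y := hev.mono fun y hy => P.contDiffAt_tNew hy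
  have hXs : ∀ᶠ y in 𝓝 z, ContDiffAt ℝ ∞ P.xNew y := hev.mono fun y hy => P.contDiffAt_xNew hy
  have c1 : ∀ e, pd e W z = pd et w (P.tNew z, P.xNew z) * pd e P.tNew z
      + pd ex w (P.tNew z, P.xNew z) * pd e P.xNew z := fun e => by
    rw [← pd_comp_base hw.self_of_nhds hTs.self_of_nhds hXs.self_of_nhds]
    exact (pd_congr h).symm
  have c2 := pd_pd_comp_base (e := ex) (e' := ex) hw hTs hXs h
  have ct := c1 et
  have cx := c1 ex
  change pd ex (pd ex W) z = _ at c2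
  rw [P.pd_ex_pd_ex_tNew hz, P.pd_ex_pd_ex_xNew hz, P.pd_ex_tNew hz, P.pd_ex_xNew hz, hW2, hAxx,
    hAx z hz] at c2
  rw [P.pd_et_tNew hz, P.pd_et_xNew hz, (hW1 et).self_of_nhds, hAt] at ct
  rw [P.pd_ex_tNew hz, P.pd_ex_xNew hz, (hW1 ex).self_of_nhds, hAx z hz] at cx
  have hcc : P.det / (P.γ * z.1 + P.δ) ^ 2 * c' = c * (P.κ / (P.γ * z.1 + P.δ)) ^ 2 := by
    rw [hc']; field_simp
  have hc1 : c * (1 / (2 * c)) = 1 / 2 := by field_simp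
  simp only [heatOp]
  have e1 : P.det / (P.γ * z.1 + P.δ) ^ 2 *
      (pd et w (P.tNew z, P.xNew z) + c' * pd ex (pd ex w) (P.tNew z, P.xNew z))
      = ε * (A z * pd et H z + (P.drift z ^ 2 / (4 * c) + P.γ / (2 * (P.γ * z.1 + P.δ))) * A z * H z)
        - P.drift z * (ε * (A z * pd ex H z + P.drift z / (2 * c) * A z * H z))
        + c * (ε * ((A z * pd ex (pd ex H) z + P.drift z / (2 * c) * A z * pd ex H z)
          + (P.drift z / (2 * c) * A z * pd ex H z + (1 / (2 * c)) * (P.drift z *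
            (P.drift z / (2 * c) * A z) + -(P.γ / (P.γ * z.1 + P.δ)) * A z) * H z))) := by
    rw [c2, cx, ct]
    linear_combination pd ex (pd ex w) (P.tNew z, P.xNew z) * hcc
  rw [e1]
  field_simp
  ring

end Params

/-- Sufficiently small balls are regular domains. -/
theorem isRegularDomain_ball (p : Space) {r : ℝ} (hr : 0 < r) :
    IsRegularDomain (Metric.ball p r) := by
  have hcv := convex_ball p r
  refine ⟨Metric.isOpen_ball, ⟨⟨p, Metric.mem_ball_self hr⟩, hcv.isPreconnected⟩, fun t x => ?_⟩
  refine Convex.ordConnected fun v hv w hw a b ha hb hab => ?_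
  have := hcv hv hw ha hb hab
  have h1 : a • ((t, x, v) : Space) + b • ((t, x, w) : Space) = (t, x, a • v + b • w) := by
    ext
    · simp [← add_mul, hab]
    · simp [← add_mul, hab]
    · simp
  rwa [h1] at this

/-- If the last component of `Φ` is constant on a slice, then `Φ` induces a diffeomorphism there. -/
theorem isDiffeoOn_slice {Ω : Set ExtSpace} {Φ : ExtSpace → ExtSpace}
    (h : IsDiffeoOn Ω Φ) {c c' : ℝ}
    (h4 : ∀ t x v, (t, x, v, c) ∈ Ω → (Φ (t, x, v, c)).2.2.2 = c') :
    IsDiffeoOn (slice Ω fun _ => c) (induced Φ fun _ => c) := by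
  obtain ⟨hO, hs, hi, hb⟩ := h
  have hι : ContDiff ℝ ∞ (fun p : Space => ((p.1, p.2.1, p.2.2, c) : ExtSpace)) := by fun_prop
  have hOs : IsOpen (slice Ω fun _ => c) := hO.preimage hι.continuous
  have hcomp : ∀ p ∈ slice Ω fun _ => c,
      ContDiffAt ℝ ∞ (fun p : Space => Φ (p.1, p.2.1, p.2.2, c)) p := fun p hp =>
    ContDiffAt.comp p (g := Φ) (f := fun p : Space => ((p.1, p.2.1, p.2.2, c) : ExtSpace))
      (hs.contDiffAt (hO.mem_nhds hp)) hι.contDiffAt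
  refine ⟨hOs, fun p hp => ?_, ?_, fun p hp => ?_⟩
  · have := hcomp p hp
    exact (this.fst.prodMk (this.snd.fst.prodMk this.snd.snd.fst)).contDiffWithinAt
  · rintro ⟨t, x, v⟩ hp ⟨t', x', v'⟩ hp' he
    simp only [induced, Prod.mk.injEq] at he
    have := hi hp hp' (Prod.ext he.1 (Prod.ext he.2.1 (Prod.ext he.2.2
      ((h4 _ _ _ hp).trans (h4 _ _ _ hp').symm))))
    simp only [Prod.mk.injEq] at this
    exact Prod.ext this.1 (Prod.ext this.2.1 this.2.2.1)
  · refine continuousLinearMap_bijective _ fun w hw => ?_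
    have hd := ((hcomp p hp).differentiableAt (by simp)).hasFDerivAt
    have hI : HasFDerivAt (induced Φ fun _ => c) _ p :=
      hd.fst.prodMk (hd.snd.fst.prodMk hd.snd.snd.fst)
    rw [hI.fderiv] at hw
    have hΦ : HasFDerivAt Φ (fderiv ℝ Φ (p.1, p.2.1, p.2.2, c)) (p.1, p.2.1, p.2.2, c) :=
      ((hs.contDiffAt (hO.mem_nhds hp)).differentiableAt (by simp)).hasFDerivAt
    have h1 := hasFDerivAt_fst (𝕜 := ℝ) (p := p)
    have h2 := hasFDerivAt_snd (𝕜 := ℝ) (p := p)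
    have hιd : HasFDerivAt (fun p : Space => ((p.1, p.2.1, p.2.2, c) : ExtSpace)) _ p :=
      h1.prodMk (h2.fst.prodMk (h2.snd.prodMk (hasFDerivAt_const c p)))
    have hch := (HasFDerivAt.comp p hΦ hιd).fderiv
    -- a vector tangent to the slice and killed by the induced map is killed by the differential of `Φ`
    have h4d : fderiv ℝ (fun p : Space => (Φ (p.1, p.2.1, p.2.2, c)).2.2.2) p = 0 := by
      have : (fun p : Space => (Φ (p.1, p.2.1, p.2.2, c)).2.2.2) =ᶠ[𝓝 p] fun _ => c' :=
        eventually_of_mem (hOs.mem_nhds hp) fun q hq => h4 _ _ _ hq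
      rw [this.fderiv_eq]; simp
    rw [hd.snd.snd.snd.fderiv] at h4d
    have h4w := DFunLike.congr_fun h4d w
    have hzero : fderiv ℝ (fun p : Space => Φ (p.1, p.2.1, p.2.2, c)) p w = 0 := by
      have hw1 := congrArg Prod.fst hw
      have hw2 := congrArg (fun q : Space => q.2.1) hw
      have hw3 := congrArg (fun q : Space => q.2.2) hw
      exact Prod.ext hw1 (Prod.ext hw2 (Prod.ext hw3 h4w))
    rw [show (fun p : Space => Φ (p.1, p.2.1, p.2.2, c))
      = Φ ∘ fun p : Space => (p.1, p.2.1, p.2.2, c) from rfl, hch] at hzero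
    have := (hb _ hp).1 (hzero.trans (map_zero _).symm)
    simp at this
    exact Prod.ext this.1 (Prod.ext this.2.1 this.2.2)

/-- A transformation of the explicit form is admissible. -/
theorem HasExplicitForm.carries {Ω : Set ExtSpace} {Φ : ExtSpace → ExtSpace} {c c' : ℝ}
    (hΦ : IsDiffeoOn Ω Φ) (hc : c ≠ 0) (hc' : c' ≠ 0) (h : HasExplicitForm Ω Φ c c') :
    Carries Ω Φ (fun _ => c) (fun _ => c') := by
  obtain ⟨⟨t₀, x₀, v₀, h₀⟩, hrep⟩ := h
  have hO : IsOpen (slice Ω fun _ => c) :=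
    hΦ.1.preimage (f := fun p : Space => ((p.1, p.2.1, p.2.2, c) : ExtSpace)) (by fun_prop)
  have hloc : ∀ p ∈ slice Ω fun _ => c, ∃ (B : Set Space) (P : Params), IsOpen B ∧ p ∈ B ∧
      P.Represents c c' B Φ := fun p hp => by
    obtain ⟨r, hr, hB⟩ := Metric.isOpen_iff.1 hO p hp
    obtain ⟨P, hP⟩ := hrep _ (isRegularDomain_ball p hr) fun t x v hm => hB hm
    exact ⟨_, P, Metric.isOpen_ball, Metric.mem_ball_self hr, hP⟩
  have h4 : ∀ t x v, (t, x, v, c) ∈ Ω → (Φ (t, x, v, c)).2.2.2 = c' := fun t x v hm => by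
    obtain ⟨B, P, -, hp, -, -, -, h4, -, hP⟩ := hloc (t, x, v) hm
    rw [(hP t x v hp).2.2, h4]
  refine ⟨⟨⟨(t₀, x₀, v₀), h₀⟩, isDiffeoOn_slice hΦ h4, ?_⟩, fun t x v hm => h4 t x v hm⟩
  intro U U' v v' hU hU' hv hv' hsub hgr
  have hvs : ∀ z ∈ U, ContDiffAt ℝ ∞ v z := fun z hz => hv.contDiffAt (hU.mem_nhds hz)
  have hvs' : ∀ z ∈ U', ContDiffAt ℝ ∞ v' z := fun z hz => hv'.contDiffAt (hU'.mem_nhds hz)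
  rw [solves_iff (fun _ => rfl) hU, solves_iff (fun _ => rfl) hU']
  have hφU : ∀ z ∈ U, ((Φ (z.1, z.2, v z, c)).1, (Φ (z.1, z.2, v z, c)).2.1) ∈ U' ∧
      (Φ (z.1, z.2, v z, c)).2.2.1
        = v' ((Φ (z.1, z.2, v z, c)).1, (Φ (z.1, z.2, v z, c)).2.1) := fun z hz => by
    have : induced Φ (fun _ => c) (z.1, z.2, v z) ∈ graphOver U' v' := by
      rw [← hgr]
      exact mem_image_of_mem _ ⟨hz, rfl⟩
    exact this
  -- the two equations are equivalent at points of the graphs that correspond to each other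
  have key : ∀ z ∈ U, burgersOp c v z = 0 ↔
      burgersOp c' v' ((Φ (z.1, z.2, v z, c)).1, (Φ (z.1, z.2, v z, c)).2.1) = 0 := by
    intro z hz
    obtain ⟨B, P, hB, hp, hdet, hκ, hk, hcc, hF2, hP⟩ := hloc (z.1, z.2, v z) (hsub ⟨hz, rfl⟩)
    have hgc : ContinuousAt (fun y : Base => ((y.1, y.2, v y) : Space)) z :=
      continuousAt_fst.prodMk (continuousAt_snd.prodMk (hvs z hz).continuousAt)
    have hnear : ∀ᶠ y in 𝓝 z, y ∈ U ∧ (y.1, y.2, v y) ∈ B :=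
      (hU.mem_nhds hz |> eventually_mem_set.2).and (hgc.eventually_mem (hB.mem_nhds hp))
    have hWopen : IsOpen {y : Base | ∃ w, (y.1, y.2, w) ∈ B} := by
      have : ∀ w, IsOpen {y : Base | (y.1, y.2, w) ∈ B} := fun w =>
        hB.preimage (f := fun z : Base => ((z.1, z.2, w) : Space)) (by fun_prop)
      simpa only [ofPred_exists] using isOpen_iUnion this
    rw [solvesHeat_iff hWopen] at hF2
    have hF2s : ∀ y : Base, (y.1, y.2, v y) ∈ B → ContDiffAt ℝ ∞ P.F2 y := fun y hy =>
      hF2.1.contDiffAt (hWopen.mem_nhds ⟨_, hy⟩)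
    have hd := (hP _ _ _ hp).1
    have hzN : ((Φ (z.1, z.2, v z, c)).1, (Φ (z.1, z.2, v z, c)).2.1) = (P.tNew z, P.xNew z) := by
      rw [(hP _ _ _ hp).2.2]; rfl
    have hN : (P.tNew z, P.xNew z) ∈ U' := by rw [← hzN]; exact (hφU z hz).1
    have hvev : ∀ᶠ y in 𝓝 z, ContDiffAt ℝ ∞ v y := eventually_of_mem (hU.mem_nhds hz) hvs
    have hvev' : ∀ᶠ y in 𝓝 (P.tNew z, P.xNew z), ContDiffAt ℝ ∞ v' y :=
      eventually_of_mem (hU'.mem_nhds hN) hvs'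
    set u : Base → ℝ := fun y => Real.exp (v y / c) with hu
    set M : Base → ℝ := fun y => P.F1 c y.1 y.2 * (u y + P.F2 y) with hM
    have hMc : ContinuousAt M z := (P.contDiffAt_F1 hc hd).continuousAt.mul
      (((hvs z hz).div_const c).exp.continuousAt.add (hF2s z hp).continuousAt)
    have hM0 : M z ≠ 0 := mul_ne_zero (P.F1_ne_zero hk hd) (hP _ _ _ hp).2.1
    -- the sign under the logarithm is locally constant
    obtain ⟨ε, hε0, hε⟩ : ∃ ε : ℝ, ε ≠ 0 ∧ ∀ᶠ y in 𝓝 z, |M y| = ε * M y := by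
      rcases lt_or_gt_of_ne hM0 with h0 | h0
      · exact ⟨-1, by norm_num, (hMc.eventually (gt_mem_nhds h0)).mono fun y hy => by
          rw [abs_of_neg hy]; ring⟩
      · exact ⟨1, by norm_num, (hMc.eventually (lt_mem_nhds h0)).mono fun y hy => by
          rw [abs_of_pos hy]; ring⟩
    have hHev : ∀ᶠ y in 𝓝 z, ContDiffAt ℝ ∞ (fun y => u y + P.F2 y) y := by
      filter_upwards [hnear] with y hy
      exact ((hvs y hy.1).div_const c).exp.add (hF2s y hy.2)
    have hw : ∀ᶠ y in 𝓝 z, Real.exp (v' (P.tNew y, P.xNew y) / c')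
        = ε * (P.F1 c y.1 y.2 * (u y + P.F2 y)) := by
      filter_upwards [hnear, hε] with y hy he
      have h1 := hφU y hy.1
      have h2 := hP _ _ _ hy.2
      rw [h2.2.2] at h1
      have h3 : P.κ ^ 2 * c / P.det = c' := by rw [hcc]; ring
      have h4 : v' (P.tNew y, P.xNew y) = c' * Real.log |M y| := by
        rw [← h3]; exact h1.2.symm
      rw [h4, mul_div_cancel_left₀ _ hc', Real.exp_log, he]
      exact abs_pos.2 (mul_ne_zero (P.F1_ne_zero hk h2.1) h2.2.1)
    have h5 := P.heatOp_explicit hc hdet hcc hd (w := fun y => Real.exp (v' y / c')) hHev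
      (hvev'.mono fun y hy => (hy.div_const c').exp) hw
    have h6 : heatOp c (fun y => u y + P.F2 y) z = heatOp c u z := by
      have hue : ∀ᶠ y in 𝓝 z, ContDiffAt ℝ ∞ u y := hvev.mono fun y hy => (hy.div_const c).exp
      have h7 := hF2.2 z ⟨_, hp⟩
      have hu0 := hue.self_of_nhds
      have hf0 := hF2s z hp
      simp only [heatOp] at h7 ⊢
      rw [pd_add hu0 hf0, pd_congr (F := pd ex fun y => u y + P.F2 y)
        (G := fun y => pd ex u y + pd ex P.F2 y) (by
          filter_upwards [hnear, hue] with y hy h8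
          rw [pd_add h8 (hF2s y hy.2)]), pd_add (contDiffAt_pd ex hu0) (contDiffAt_pd ex hf0)]
      linear_combination h7
    rw [h6, heatOp_exp hc hvev, heatOp_exp hc' hvev'] at h5
    rw [hzN]
    have g1 : P.det / (P.γ * z.1 + P.δ) ^ 2 *
        (Real.exp (v' (P.tNew z, P.xNew z) / c') / c') ≠ 0 :=
      mul_ne_zero (div_ne_zero hdet (pow_ne_zero 2 hd)) (div_ne_zero (Real.exp_pos _).ne' hc')
    have g2 : ε * P.F1 c z.1 z.2 * (Real.exp (v z / c) / c) ≠ 0 :=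
      mul_ne_zero (mul_ne_zero hε0 (P.F1_ne_zero hk hd)) (div_ne_zero (Real.exp_pos _).ne' hc)
    constructor
    · intro h0
      rw [h0] at h5
      exact mul_left_cancel₀ g1 (by linear_combination h5)
    · intro h0
      rw [h0] at h5
      exact mul_left_cancel₀ g2 (by linear_combination -h5)
  constructor
  · rintro ⟨-, h1⟩
    refine ⟨hv', fun y hy => ?_⟩
    have hy' : (y.1, y.2, v' y) ∈ graphOver U' v' := ⟨hy, rfl⟩
    rw [← hgr] at hy'
    obtain ⟨⟨t, x, r⟩, ⟨hm, hr⟩, he⟩ := hy'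
    simp only at hm hr
    subst hr
    simp only [induced, Prod.mk.injEq] at he
    have := (key (t, x) hm).1 (h1 _ hm)
    simp only at this
    rwa [he.1, he.2.1] at this
  · rintro ⟨-, h1⟩
    exact ⟨hv, fun z hz => (key z hz).2 (h1 _ (hφU z hz).1)⟩

/-! ### Uniqueness of the parameters -/

namespace Params

variable {c c' : ℝ} {U : Set Space} {Φ : ExtSpace → ExtSpace}

/-- Multiplication of the tuple of the first five parameters by a number. The factor `k` is changed so
that `F¹` is preserved, which is needed only if `F¹` contains `√|γ t + δ|`, that is, if `γ ≠ 0`. -/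
def rescale (P : Params) (r : ℝ) : Params :=
  { P with
    α := r * P.α, β := r * P.β, γ := r * P.γ, δ := r * P.δ, κ := r * P.κ
    k := if P.γ = 0 then P.k else P.k / √|r| }

theorem tuple_rescale (P : Params) (r : ℝ) : (P.rescale r).tuple = r • P.tuple := by
  ext i; fin_cases i <;> simp [tuple, rescale]

theorem F1_rescale (P : Params) {r : ℝ} (hr : r ≠ 0) (t x : ℝ) :
    (P.rescale r).F1 c t x = P.F1 c t x := by
  by_cases hγ : P.γ = 0
  · simp [F1, rescale, hγ]
  · have h1 : r * P.γ ≠ 0 := mul_ne_zero hr hγ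
    have h2 : √|r| ≠ 0 := by positivity
    simp only [F1, rescale, hγ, h1, if_false]
    rw [show r * P.γ * t + r * P.δ = r * (P.γ * t + P.δ) by ring, abs_mul,
      Real.sqrt_mul (abs_nonneg r)]
    congr 1
    · field_simp
    · congr 2
      rw [show (r * P.γ * x - P.μ₁ * (r * P.δ) + P.μ₀ * (r * P.γ)) ^ 2
        = r ^ 2 * (P.γ * x - P.μ₁ * P.δ + P.μ₀ * P.γ) ^ 2 by ring,
        show 4 * c * (r * P.γ) * (r * (P.γ * t + P.δ))
          = r ^ 2 * (4 * c * P.γ * (P.γ * t + P.δ)) by ring,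
        mul_div_mul_left _ _ (pow_ne_zero 2 hr)]

theorem Represents.rescale {P : Params} (h : P.Represents c c' U Φ) {r : ℝ} (hr : r ≠ 0) :
    (P.rescale r).Represents c c' U Φ := by
  obtain ⟨h1, h2, h3, h4, h5, h6⟩ := h
  have hdet : (P.rescale r).det = r ^ 2 * P.det := by simp only [det, Params.rescale]; ring
  have hκ : (P.rescale r).κ = r * P.κ := rfl
  have e1 : (r * P.κ) ^ 2 / (r ^ 2 * P.det) = P.κ ^ 2 / P.det := by field_simp
  have e2 : (r * P.κ) ^ 2 * c / (r ^ 2 * P.det) = P.κ ^ 2 * c / P.det := by field_simp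
  refine ⟨by rw [hdet]; positivity, mul_ne_zero hr h2, ?_, by rw [hdet, hκ, e1, h4], h5,
    fun t x v hv => ?_⟩
  · simp only [Params.rescale]
    split_ifs
    · exact h3
    · exact div_ne_zero h3 (by positivity)
  · obtain ⟨k1, k2, k3⟩ := h6 t x v hv
    have hS : r * P.γ * t + r * P.δ = r * (P.γ * t + P.δ) := by ring
    refine ⟨by change r * P.γ * t + r * P.δ ≠ 0; rw [hS]; exact mul_ne_zero hr k1, k2, ?_⟩
    rw [k3, F1_rescale P hr, hdet, hκ, e1, e2]
    refine Prod.ext ?_ (Prod.ext ?_ rfl)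
    · change _ = (r * P.α * t + r * P.β) / (r * P.γ * t + r * P.δ)
      rw [hS]; field_simp
    · change _ = r * P.κ * ((x + P.μ₁ * t + P.μ₀) / (r * P.γ * t + r * P.δ))
      rw [hS]; field_simp

/-- Two representations have proportional tuples: the factor is the ratio of the values of `κ`, as is
seen from the dependence of the new `x` on the old one. -/
theorem Represents.tuple_eq {P Q : Params} (hU : IsOpen U) (hne : U.Nonempty)
    (hP : P.Represents c c' U Φ) (hQ : Q.Represents c c' U Φ) :
    ∃ r : ℝ, r ≠ 0 ∧ Q.tuple = r • P.tuple := by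
  obtain ⟨⟨t₀, x₀, v₀⟩, h₀⟩ := hne
  obtain ⟨s, hs, hB⟩ := Metric.isOpen_iff.1 hU _ h₀
  obtain ⟨-, hκ, -, -, -, hP⟩ := hP
  obtain ⟨-, hκ', -, -, -, hQ⟩ := hQ
  have hm : ∀ a b : ℝ, |a| < s → |b| < s → (t₀ + a, x₀ + b, v₀) ∈ U := fun a b ha hb =>
    hB (by simp [Prod.dist_eq, ha, hb])
  have hh : |s / 2| < s := by rw [abs_of_pos (by positivity)]; linarith
  have h0 : |(0 : ℝ)| < s := by simpa using hs
  have hs2 : s / 2 ≠ 0 := by positivity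
  have key : ∀ a, |a| < s →
      P.κ * (Q.γ * (t₀ + a) + Q.δ) = Q.κ * (P.γ * (t₀ + a) + P.δ) ∧
      P.κ * (Q.α * (t₀ + a) + Q.β) = Q.κ * (P.α * (t₀ + a) + P.β) := by
    intro a ha
    obtain ⟨d1, -, e1⟩ := hP _ _ _ (hm a 0 ha h0)
    obtain ⟨d2, -, e2⟩ := hQ _ _ _ (hm a 0 ha h0)
    obtain ⟨-, -, e3⟩ := hP _ _ _ (hm a (s / 2) ha hh)
    obtain ⟨-, -, e4⟩ := hQ _ _ _ (hm a (s / 2) ha hh)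
    rw [e1] at e2
    rw [e3] at e4
    simp only [Prod.mk.injEq] at e2 e4
    obtain ⟨f1, f2, -⟩ := e2
    obtain ⟨-, f4, -⟩ := e4
    rw [div_eq_div_iff d1 d2] at f1
    rw [mul_div_assoc', mul_div_assoc', div_eq_div_iff d1 d2] at f2 f4
    have g : P.κ * (Q.γ * (t₀ + a) + Q.δ) = Q.κ * (P.γ * (t₀ + a) + P.δ) :=
      mul_left_cancel₀ hs2 (by linear_combination f4 - f2)
    refine ⟨g, mul_right_cancel₀ d1 ?_⟩
    linear_combination -P.κ * f1 + (P.α * (t₀ + a) + P.β) * g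
  obtain ⟨a1, a2⟩ := key 0 h0
  obtain ⟨b1, b2⟩ := key (s / 2) hh
  have hγ : P.κ * Q.γ = Q.κ * P.γ := mul_left_cancel₀ hs2 (by linear_combination b1 - a1)
  have hα : P.κ * Q.α = Q.κ * P.α := mul_left_cancel₀ hs2 (by linear_combination b2 - a2)
  have hδ : P.κ * Q.δ = Q.κ * P.δ := by linear_combination a1 - t₀ * hγ
  have hβ : P.κ * Q.β = Q.κ * P.β := by linear_combination a2 - t₀ * hα
  refine ⟨Q.κ / P.κ, div_ne_zero hκ' hκ, ?_⟩
  ext i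
  fin_cases i <;> simp [tuple] <;> field_simp
  · linear_combination hα
  · linear_combination hβ
  · linear_combination hγ
  · linear_combination hδ

end Params

/-! ### Scalings -/

/-- The scaling `(t, x, v) ↦ (l t, x, v / l)` maps the equation with the constant `d` to the one with
`d / l`. For `l = 0` the statement is a triviality about the zero function. -/
theorem solves_scale {d l : ℝ} {U : Set Base} (hU : IsOpen U) {v : Base → ℝ}
    (h : Solves (fun _ => d) U v) :
    Solves (fun _ => d / l) {y | (y.1 / l, y.2) ∈ U} (fun y => v (y.1 / l, y.2) / l) := by
  have hcont : ContDiff ℝ ∞ (fun y : Base => ((y.1 / l, y.2) : Base)) := by fun_prop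
  have hO : IsOpen {y : Base | (y.1 / l, y.2) ∈ U} := hU.preimage hcont.continuous
  rw [solves_iff (fun _ => rfl) hU] at h
  rw [solves_iff (fun _ => rfl) hO]
  have hv : ∀ y ∈ U, ContDiffAt ℝ ∞ v y := fun y hy => h.1.contDiffAt (hU.mem_nhds hy)
  have hvc : ∀ (G : Base → ℝ) (y : Base), ContDiffAt ℝ ∞ G (y.1 / l, y.2) →
      ContDiffAt ℝ ∞ (fun y : Base => G (y.1 / l, y.2)) y := fun G y hG =>
    ContDiffAt.comp y (f := fun y : Base => ((y.1 / l, y.2) : Base)) hG hcont.contDiffAt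
  have hpd : ∀ (G : Base → ℝ) (y : Base), ContDiffAt ℝ ∞ G (y.1 / l, y.2) →
      pd et (fun y : Base => l⁻¹ * G (y.1 / l, y.2)) y = l⁻¹ * (l⁻¹ * pd et G (y.1 / l, y.2)) ∧
      pd ex (fun y : Base => l⁻¹ * G (y.1 / l, y.2)) y = l⁻¹ * pd ex G (y.1 / l, y.2) := by
    rintro G ⟨t, x⟩ hG
    have h1 : ContDiffAt ℝ ∞ (fun y : Base => l⁻¹ * G (y.1 / l, y.2)) (t, x) :=
      contDiffAt_const.mul (hvc G (t, x) hG)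
    constructor
    · refine pd_et_of_hasDerivAt h1 ?_
      have h2 := HasDerivAt.scomp t (h := fun s => s / l) (hasDerivAt_slice_t hG)
        ((hasDerivAt_id t).div_const l)
      refine (h2.const_mul l⁻¹).congr_deriv ?_
      simp
    · exact pd_ex_of_hasDerivAt h1 ((hasDerivAt_slice_x hG).const_mul l⁻¹)
  refine ⟨fun y hy => ((hvc v y (hv _ hy)).div_const l).contDiffWithinAt, fun y hy => ?_⟩
  have hb := h.2 _ hy
  have e : (fun y : Base => v (y.1 / l, y.2) / l) = fun y => l⁻¹ * v (y.1 / l, y.2) :=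
    funext fun y => by ring
  have h2 : pd ex (pd ex fun y : Base => l⁻¹ * v (y.1 / l, y.2)) y
      = l⁻¹ * pd ex (pd ex v) (y.1 / l, y.2) := by
    rw [pd_congr_on hO (fun z hz => (hpd v z (hv _ hz)).2) hy]
    exact (hpd _ y (contDiffAt_pd ex (hv _ hy))).2
  rw [e, burgersOp, h2, (hpd v y (hv _ hy)).1, (hpd v y (hv _ hy)).2]
  rw [burgersOp] at hb
  linear_combination l⁻¹ ^ 2 * hb

theorem solves_scale_iff {d l : ℝ} (hl : l ≠ 0) {U : Set Base} (hU : IsOpen U) {v : Base → ℝ} :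
    Solves (fun _ => l * d) U v ↔
      Solves (fun _ => d) {y | (y.1 / l, y.2) ∈ U} (fun y => v (y.1 / l, y.2) / l) := by
  constructor
  · intro h
    have := solves_scale (l := l) hU h
    rwa [mul_div_cancel_left₀ _ hl] at this
  · intro h
    have hO : IsOpen {y : Base | (y.1 / l, y.2) ∈ U} :=
      hU.preimage (f := fun y : Base => ((y.1 / l, y.2) : Base)) (by fun_prop)
    have := solves_scale (l := l⁻¹) hO h
    simp only [div_inv_eq_mul, mem_ofPred_eq, mul_div_cancel_right₀ _ hl, div_mul_cancel₀ _ hl,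
      mul_comm d l] at this
    exact this

/-- Conjugation by the scaling `(t, x, v) ↦ (t / l, x, l v)`, which takes the equation with the
constant `c` to the one with the constant `l c`. -/
def conj (l : ℝ) (φ : Space → Space) (p : Space) : Space :=
  ((φ (l * p.1, p.2.1, p.2.2 / l)).1 / l, (φ (l * p.1, p.2.1, p.2.2 / l)).2.1,
    l * (φ (l * p.1, p.2.1, p.2.2 / l)).2.2)

theorem mapsEquation_conj {c c' l : ℝ} (hl : l ≠ 0) {D : Set Space} {φ : Space → Space}
    (h : MapsEquation (fun _ => c) (fun _ => c') D φ) :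
    MapsEquation (fun _ => l * c) (fun _ => l * c') {p | (l * p.1, p.2.1, p.2.2 / l) ∈ D}
      (conj l φ) := by
  intro U U' v v' hU hU' hv hv' hsub hgr
  have hcont : ContDiff ℝ ∞ (fun y : Base => ((y.1 / l, y.2) : Base)) := by fun_prop
  rw [solves_scale_iff hl hU, solves_scale_iff hl hU']
  refine h _ _ _ _ (hU.preimage hcont.continuous) (hU'.preimage hcont.continuous)
    ((hv.comp hcont.contDiffOn fun y hy => hy).div_const l)
    ((hv'.comp hcont.contDiffOn fun y hy => hy).div_const l) ?_ ?_
  · rintro ⟨t, x, w⟩ ⟨hm, hw⟩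
    simp only at hw
    subst hw
    have := hsub (show (t / l, x, v (t / l, x)) ∈ graphOver U v from ⟨hm, rfl⟩)
    simpa [mul_div_cancel₀ _ hl] using this
  · ext q
    constructor
    · rintro ⟨⟨t, x, w⟩, ⟨hm, hw⟩, rfl⟩
      simp only at hw
      subst hw
      have h1 : conj l φ (t / l, x, v (t / l, x)) ∈ graphOver U' v' := by
        rw [← hgr]; exact mem_image_of_mem _ ⟨hm, rfl⟩
      simp only [conj, mul_div_cancel₀ _ hl] at h1
      refine ⟨h1.1, ?_⟩
      rw [eq_div_iff hl, mul_comm]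
      exact h1.2
    · rintro ⟨hm, hw⟩
      have h1 : (q.1 / l, q.2.1, v' (q.1 / l, q.2.1)) ∈ graphOver U' v' := ⟨hm, rfl⟩
      rw [← hgr] at h1
      obtain ⟨⟨t, x, w⟩, ⟨hm1, hw1⟩, he⟩ := h1
      simp only at hw1
      subst hw1
      simp only [conj, Prod.mk.injEq] at he
      refine ⟨(l * t, x, v (t, x) / l), ⟨?_, ?_⟩, ?_⟩
      · simpa [mul_div_cancel_left₀ _ hl] using hm1
      · simp [mul_div_cancel_left₀ _ hl]
      · obtain ⟨e1, e2, e3⟩ := he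
        refine Prod.ext ?_ (Prod.ext e2 ?_)
        · exact (div_left_inj' hl).1 e1
        · rw [hw, eq_div_iff hl, mul_comm]; exact e3

theorem isDiffeoOn_of_leftInv {E : Type*} [NormedAddCommGroup E] [NormedSpace ℝ E]
    [FiniteDimensional ℝ E] {O : Set E} {F G : E → E} (hO : IsOpen O)
    (hF : ∀ p ∈ O, ContDiffAt ℝ ∞ F p) (hG : ∀ p ∈ O, DifferentiableAt ℝ G (F p))
    (h : ∀ p ∈ O, G (F p) = p) : IsDiffeoOn O F := by
  refine ⟨hO, fun p hp => (hF p hp).contDiffWithinAt, fun p hp q hq e => ?_, fun p hp => ?_⟩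
  · rw [← h p hp, ← h q hq, e]
  · refine continuousLinearMap_bijective _ fun w hw => ?_
    have h1 := (hG p hp).hasFDerivAt.comp p ((hF p hp).differentiableAt (by simp)).hasFDerivAt
    have h2 : HasFDerivAt (G ∘ F) (ContinuousLinearMap.id ℝ E) p :=
      (hasFDerivAt_id p).congr_of_eventuallyEq (eventually_of_mem (hO.mem_nhds hp) h)
    have h3 := DFunLike.congr_fun (h1.unique h2) w
    simp only [ContinuousLinearMap.comp_apply, hw, map_zero] at h3
    exact h3.symm

theorem IsDiffeoOn.comp {E : Type*} [NormedAddCommGroup E] [NormedSpace ℝ E] {D D' : Set E}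
    {φ ψ : E → E} (hψ : IsDiffeoOn D' ψ) (hφ : IsDiffeoOn D φ) :
    IsDiffeoOn (D ∩ φ ⁻¹' D') (ψ ∘ φ) := by
  refine ⟨hφ.2.1.continuousOn.isOpen_inter_preimage hφ.1 hψ.1,
    hψ.2.1.comp (hφ.2.1.mono inter_subset_left) fun p hp => hp.2,
    fun p hp q hq e => hφ.2.2.1 hp.1 hq.1 (hψ.2.2.1 hp.2 hq.2 e), fun p hp => ?_⟩
  have h1 := ((hφ.2.1.contDiffAt (hφ.1.mem_nhds hp.1)).differentiableAt (by simp)).hasFDerivAt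
  have h2 := ((hψ.2.1.contDiffAt (hψ.1.mem_nhds hp.2)).differentiableAt (by simp)).hasFDerivAt
  rw [(h2.comp p h1).fderiv]
  exact (hψ.2.2.2 _ hp.2).comp (hφ.2.2.2 p hp.1)

/-- The map `(t, x, v, f) ↦ (l t, x, v / l, l)`, where `l = f / c`. -/
def extScale (c : ℝ) (p : ExtSpace) : ExtSpace :=
  (p.2.2.2 / c * p.1, p.2.1, p.2.2.1 / (p.2.2.2 / c), p.2.2.2 / c)

/-- The inverse of `extScale c`. -/
def extUnscale (c : ℝ) (p : ExtSpace) : ExtSpace :=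
  (p.1 / p.2.2.2, p.2.1, p.2.2.2 * p.2.2.1, p.2.2.2 * c)

/-- The set of the points whose last coordinate is nonzero. -/
def lastNeZero : Set ExtSpace := {p | p.2.2.2 ≠ 0}

theorem isOpen_lastNeZero : IsOpen lastNeZero :=
  isOpen_ne_fun (by fun_prop) (by fun_prop)

theorem contDiffAt_extScale {c : ℝ} (hc : c ≠ 0) {p : ExtSpace} (hp : p ∈ lastNeZero) :
    ContDiffAt ℝ ∞ (extScale c) p := by
  have h : ContDiffAt ℝ ∞ (fun p : ExtSpace => p.2.2.1 / (p.2.2.2 / c)) p :=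
    ContDiffAt.div (by fun_prop) (by fun_prop) (div_ne_zero hp hc)
  exact ContDiffAt.prodMk (by fun_prop) (ContDiffAt.prodMk (by fun_prop) (h.prodMk (by fun_prop)))

theorem contDiffAt_extUnscale {c : ℝ} {p : ExtSpace} (hp : p ∈ lastNeZero) :
    ContDiffAt ℝ ∞ (extUnscale c) p := by
  have h : ContDiffAt ℝ ∞ (fun p : ExtSpace => p.1 / p.2.2.2) p :=
    ContDiffAt.div (by fun_prop) (by fun_prop) hp
  exact h.prodMk (by fun_prop)

theorem extUnscale_extScale {c : ℝ} (hc : c ≠ 0) {p : ExtSpace} (hp : p ∈ lastNeZero) :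
    extUnscale c (extScale c p) = p := by
  obtain ⟨t, x, v, f⟩ := p
  have h : f / c ≠ 0 := div_ne_zero hp hc
  simp only [extUnscale, extScale]
  rw [mul_div_cancel_left₀ _ h, mul_div_cancel₀ _ h, div_mul_cancel₀ _ hc]

theorem extScale_extUnscale {c : ℝ} (hc : c ≠ 0) {p : ExtSpace} (hp : p ∈ lastNeZero) :
    extScale c (extUnscale c p) = p := by
  obtain ⟨t, x, v, l⟩ := p
  have h : l ≠ 0 := hp
  simp only [extUnscale, extScale]
  rw [mul_div_cancel_right₀ _ hc, mul_div_cancel₀ _ h, mul_div_cancel_left₀ _ h]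

theorem isDiffeoOn_extScale {c : ℝ} (hc : c ≠ 0) : IsDiffeoOn lastNeZero (extScale c) :=
  isDiffeoOn_of_leftInv isOpen_lastNeZero (fun _ hp => contDiffAt_extScale hc hp)
    (fun _ hp => (contDiffAt_extUnscale (div_ne_zero hp hc)).differentiableAt (by simp))
    fun _ hp => extUnscale_extScale hc hp

theorem isDiffeoOn_extUnscale {c : ℝ} (hc : c ≠ 0) : IsDiffeoOn lastNeZero (extUnscale c) :=
  isDiffeoOn_of_leftInv isOpen_lastNeZero (fun _ hp => contDiffAt_extUnscale hp)
    (fun _ hp => (contDiffAt_extScale hc (mul_ne_zero hp hc)).differentiableAt (by simp))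
    fun _ hp => extScale_extUnscale hc hp

/-- The extension of a transformation of the space of `(t, x, v)` by the identity in the last
coordinate. -/
def extendId (φ : Space → Space) (p : ExtSpace) : ExtSpace :=
  ((φ (p.1, p.2.1, p.2.2.1)).1, (φ (p.1, p.2.1, p.2.2.1)).2.1, (φ (p.1, p.2.1, p.2.2.1)).2.2,
    p.2.2.2)

theorem isDiffeoOn_extendId {D : Set Space} {φ : Space → Space} (h : IsDiffeoOn D φ) :
    IsDiffeoOn {p : ExtSpace | (p.1, p.2.1, p.2.2.1) ∈ D} (extendId φ) := by
  have hι : ContDiff ℝ ∞ (fun p : ExtSpace => ((p.1, p.2.1, p.2.2.1) : Space)) := by fun_prop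
  have hcomp : ∀ p ∈ {p : ExtSpace | (p.1, p.2.1, p.2.2.1) ∈ D},
      ContDiffAt ℝ ∞ (fun p : ExtSpace => φ (p.1, p.2.1, p.2.2.1)) p := fun p hp =>
    ContDiffAt.comp p (g := φ) (f := fun p : ExtSpace => ((p.1, p.2.1, p.2.2.1) : Space))
      (h.2.1.contDiffAt (h.1.mem_nhds hp)) hι.contDiffAt
  refine ⟨h.1.preimage hι.continuous, fun p hp => ?_, fun p hp q hq e => ?_, fun p hp => ?_⟩
  · have := hcomp p hp
    exact (this.fst.prodMk (this.snd.fst.prodMk (this.snd.snd.prodMk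
      (by fun_prop)))).contDiffWithinAt
  · simp only [extendId, Prod.mk.injEq] at e
    have := h.2.2.1 hp hq (Prod.ext e.1 (Prod.ext e.2.1 e.2.2.1))
    simp only [Prod.mk.injEq] at this
    exact Prod.ext this.1 (Prod.ext this.2.1 (Prod.ext this.2.2 e.2.2.2))
  · refine continuousLinearMap_bijective _ fun w hw => ?_
    have hd := ((hcomp p hp).differentiableAt (by simp)).hasFDerivAt
    have h1 := hasFDerivAt_fst (𝕜 := ℝ) (p := p)
    have h2 := hasFDerivAt_snd (𝕜 := ℝ) (p := p)
    have hE : HasFDerivAt (extendId φ) _ p :=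
      hd.fst.prodMk (hd.snd.fst.prodMk (hd.snd.snd.prodMk h2.snd.snd))
    have hφd : HasFDerivAt φ (fderiv ℝ φ (p.1, p.2.1, p.2.2.1)) (p.1, p.2.1, p.2.2.1) :=
      ((h.2.1.contDiffAt (h.1.mem_nhds hp)).differentiableAt (by simp)).hasFDerivAt
    have hιd : HasFDerivAt (fun p : ExtSpace => ((p.1, p.2.1, p.2.2.1) : Space)) _ p :=
      h1.prodMk (h2.fst.prodMk h2.snd.fst)
    have hch := (HasFDerivAt.comp p hφd hιd).fderiv
    rw [hE.fderiv] at hw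
    have hw1 := congrArg Prod.fst hw
    have hw2 := congrArg (fun q : ExtSpace => q.2.1) hw
    have hw3 := congrArg (fun q : ExtSpace => q.2.2.1) hw
    have hzero : fderiv ℝ (fun p : ExtSpace => φ (p.1, p.2.1, p.2.2.1)) p w = 0 :=
      Prod.ext hw1 (Prod.ext hw2 hw3)
    have hw4 : w.2.2.2 = 0 := congrArg (fun q : ExtSpace => q.2.2.2) hw
    rw [show (fun p : ExtSpace => φ (p.1, p.2.1, p.2.2.1))
      = φ ∘ fun p : ExtSpace => (p.1, p.2.1, p.2.2.1) from rfl, hch] at hzero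
    have := (h.2.2.2 _ hp).1 (hzero.trans (map_zero _).symm)
    simp at this
    exact Prod.ext this.1 (Prod.ext this.2.1 (Prod.ext this.2.2 hw4))

/-! ### Normalization -/

theorem const_mem_P3 {c : ℝ} (hc : c ≠ 0) : (fun _ => c) ∈ P3 :=
  ⟨⟨contDiff_const, fun _ => hc⟩, c, fun _ => rfl⟩

theorem exists_const_of_mem_P3 {f : Base → ℝ} (hf : f ∈ P3) : ∃ c : ℝ, c ≠ 0 ∧ f = fun _ => c := by
  obtain ⟨⟨-, h0⟩, c, h⟩ := hf
  exact ⟨c, by rw [← h 0]; exact h0 0, funext h⟩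

/-- A transformation between two equations with constant arbitrary elements is extended to all the
constants by means of scalings. -/
theorem isGenNormalized_P3 : IsGenNormalized P3 := by
  intro f hf f' hf' D φ hadm
  obtain ⟨c, hc, rfl⟩ := exists_const_of_mem_P3 hf
  obtain ⟨c', hc', rfl⟩ := exists_const_of_mem_P3 hf'
  obtain ⟨⟨p₀, hp₀⟩, hφ, hmap⟩ := hadm
  set Ω : Set ExtSpace := {p | p.2.2.2 ≠ 0 ∧
    (p.2.2.2 / c * p.1, p.2.1, p.2.2.1 / (p.2.2.2 / c)) ∈ D} with hΩ
  set Φ : ExtSpace → ExtSpace := extUnscale c' ∘ extendId φ ∘ extScale c with hΦd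
  have hΦ : IsDiffeoOn Ω Φ := by
    have := (isDiffeoOn_extUnscale hc').comp
      ((isDiffeoOn_extendId hφ).comp (isDiffeoOn_extScale hc))
    convert this using 1
    ext p
    exact ⟨fun hp => ⟨hp, div_ne_zero hp.1 hc⟩, fun hp => hp.1⟩
  have hind : ∀ d, induced Φ (fun _ => d) = conj (d / c) φ := fun d => rfl
  have hslice : ∀ d, d ≠ 0 → slice Ω (fun _ => d)
      = {p | (d / c * p.1, p.2.1, p.2.2 / (d / c)) ∈ D} := fun d hd => by
    ext p; exact ⟨fun hp => hp.2, fun hp => ⟨hd, hp⟩⟩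
  have hcar : ∀ d, d ≠ 0 → Carries Ω Φ (fun _ => d) (fun _ => d / c * c') := fun d hd => by
    have hl : d / c ≠ 0 := div_ne_zero hd hc
    refine ⟨⟨⟨(p₀.1 / (d / c), p₀.2.1, d / c * p₀.2.2), hd, ?_⟩, isDiffeoOn_slice (c' := d / c * c') hΦ
      fun _ _ _ _ => rfl, ?_⟩, fun _ _ _ _ => rfl⟩
    · simp only [mul_div_cancel₀ _ hl, mul_div_cancel_left₀ _ hl]
      exact hp₀
    · have := mapsEquation_conj hl hmap
      rw [hind, hslice d hd]
      rwa [div_mul_cancel₀ _ hc] at this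
  have hone : c / c = 1 := div_self hc
  refine ⟨Ω, Φ, ⟨⟨hΦ, fun p hp => ⟨hp.1, mul_ne_zero (div_ne_zero hp.1 hc) hc'⟩⟩, ?_, ?_⟩, ?_, ?_, ?_⟩
  · intro g hg
    obtain ⟨d, hd, rfl⟩ := exists_const_of_mem_P3 hg
    exact ⟨_, const_mem_P3 (mul_ne_zero (div_ne_zero hd hc) hc'), hcar d hd⟩
  · intro g hg
    obtain ⟨d, hd, rfl⟩ := exists_const_of_mem_P3 hg
    have hd' : d / c' * c ≠ 0 := mul_ne_zero (div_ne_zero hd hc') hc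
    refine ⟨_, const_mem_P3 hd', ?_⟩
    have := hcar _ hd'
    rwa [mul_div_cancel_right₀ _ hc, div_mul_cancel₀ _ hc'] at this
  · have := hcar c hc
    rwa [hone, one_mul] at this
  · rw [hslice c hc, hone]
    simp
  · intro p _
    rw [hind, hone]
    simp [conj]

end PotBurgers

end

theorem proposition2 :
    -- the generalized equivalence group
    (∀ (Ω : Set PotBurgers.ExtSpace) (Φ : PotBurgers.ExtSpace → PotBurgers.ExtSpace),
      PotBurgers.IsGenEquivalence PotBurgers.P3 Ω Φ ↔
        PotBurgers.IsExtTransformation Ω Φ ∧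
        (∀ c : ℝ, c ≠ 0 → ∃ c' : ℝ, c' ≠ 0 ∧ PotBurgers.HasExplicitForm Ω Φ c c') ∧
        (∀ c' : ℝ, c' ≠ 0 → ∃ c : ℝ, c ≠ 0 ∧ PotBurgers.HasExplicitForm Ω Φ c c')) ∧
    -- the tuple of the first five parameters is defined up to a nonzero multiplier
    (∀ (c c' : ℝ) (U : Set PotBurgers.Space) (Φ : PotBurgers.ExtSpace → PotBurgers.ExtSpace)
        (P : PotBurgers.Params),
      c ≠ 0 → IsOpen U → U.Nonempty → P.Represents c c' U Φ →
        ∀ τ : Fin 5 → ℝ,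
          (∃ Q : PotBurgers.Params, Q.Represents c c' U Φ ∧ Q.tuple = τ) ↔
            ∃ r : ℝ, r ≠ 0 ∧ τ = r • P.tuple) ∧
    -- normalization
    PotBurgers.IsGenNormalized PotBurgers.P3 := by
  refine ⟨fun Ω Φ => ?_, fun c c' U Φ P _ hU hne hP τ => ⟨?_, ?_⟩, PotBurgers.isGenNormalized_P3⟩
  · have explicit : ∀ c c' : ℝ, c ≠ 0 → c' ≠ 0 →
        PotBurgers.Carries Ω Φ (fun _ => c) (fun _ => c') →
        PotBurgers.HasExplicitForm Ω Φ c c' := fun c c' hc hc' h => by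
      obtain ⟨p, hp⟩ := h.1.1
      exact ⟨⟨p.1, p.2.1, p.2.2, hp⟩, fun U hU hUΩ =>
        PotBurgers.exists_represents hc hc' (fun _ => rfl) (fun _ => rfl) h hU hUΩ⟩
    refine and_congr_right fun hΦ => and_congr ⟨fun h c hc => ?_, fun h f hf => ?_⟩
      ⟨fun h c' hc' => ?_, fun h f' hf' => ?_⟩
    · obtain ⟨f', hf', h'⟩ := h _ (PotBurgers.const_mem_P3 hc)
      obtain ⟨c', hc', rfl⟩ := PotBurgers.exists_const_of_mem_P3 hf'
      exact ⟨c', hc', explicit c c' hc hc' h'⟩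
    · obtain ⟨c, hc, rfl⟩ := PotBurgers.exists_const_of_mem_P3 hf
      obtain ⟨c', hc', h'⟩ := h c hc
      exact ⟨_, PotBurgers.const_mem_P3 hc', h'.carries hΦ.1 hc hc'⟩
    · obtain ⟨f, hf, h'⟩ := h _ (PotBurgers.const_mem_P3 hc')
      obtain ⟨c, hc, rfl⟩ := PotBurgers.exists_const_of_mem_P3 hf
      exact ⟨c, hc, explicit c c' hc hc' h'⟩
    · obtain ⟨c', hc', rfl⟩ := PotBurgers.exists_const_of_mem_P3 hf'
      obtain ⟨c, hc, h'⟩ := h c' hc'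
      exact ⟨_, PotBurgers.const_mem_P3 hc, h'.carries hΦ.1 hc hc'⟩
  · rintro ⟨Q, hQ, rfl⟩
    exact PotBurgers.Params.Represents.tuple_eq hU hne hP hQ
  · rintro ⟨r, hr, rfl⟩
    exact ⟨P.rescale r, hP.rescale hr, P.tuple_rescale r⟩
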